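/- For a matrix $A$ let $\|A\|$ denote its trace norm (the sum of its singular values). For $d\ge 1$ let $\mu_d$ be the Haar (unitarily invariant) probability measure on unit vectors of $\mathbb{C}^d$, and for a unit vector $|\psi\rangle$ write $\psi=|\psi\rangle\langle\psi|$. An $\ell$-qubit state is a unit vector of $(\mathbb{C}^2)^{\otimes \ell}\cong\mathbb{C}^{2^\ell}$. **Theorem (stretching).** Let $m,n,r$ be natural numbers with $1\le r<m$, and let $\{U_k\}_{k\in\{0,1\}^n}$ be any family of unitaries on $m-1$ qubits. Then $$\Big\| \mathop{\mathbb{E}}_{k}\ \mathop{\mathbb{E}}_{|\psi\rangle\leftarrow\mu_{2^m}} (I\otimes U_k)\,\psi\,(I\otimes U_k^\dagger)\otimes\psi^{\otimes (r-1)} \;-\; \mathop{\mathbb{E}}_{|\psi\rangle\leftarrow\mu_{2^m}} \frac{I}{2^m}\otimes\psi^{\otimes (r-1)} \Big\|$$ $$\le\; 5\,\Big\| \mathop{\mathbb{E}}_{k}\ \mathop{\mathbb{E}}_{|\psi'\rangle\leftarrow\mu_{2^{m-1}}} U_k\,\psi'\,U_k^\dagger\otimes\psi'^{\otimes (r-1)}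 \;-\; \mathop{\mathbb{E}}_{|\psi'\rangle\leftarrow\mu_{2^{m-1}}} \frac{I}{2^{m-1}}\otimes\psi'^{\otimes (r-1)} \Big\| \;+\; \frac{800\,r\sqrt m}{2^{m/2}},$$ where $k$ is uniform on $\{0,1\}^n$, $|\psi\rangle$ is a Haar random $m$-qubit state, $|\psi'\rangle$ is a Haar random $(m-1)$-qubit state, and $I\otimes U_k$ acts as the identity on the first qubit and as $U_k$ on the last $m-1$ qubits. -/

import Mathlib

open MeasureTheory Matrix
open scoped Kronecker

noncomputable section

/-- Bit strings of length `m`, labelling the computational basis of `m` qubits. -/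
abbrev Qubits (m : ℕ) : Type := Fin m → Fin 2

/-- Unit vectors of the Hilbert space `ℂ^ι`. -/
abbrev PureState (ι : Type) [Fintype ι] : Type :=
  Metric.sphere (0 : EuclideanSpace ℂ ι) 1

/-- The Haar measure on pure states: the rotation-invariant surface measure on the unit sphere
of `ℂ^ι`, normalised to total mass one. -/
def haarState (ι : Type) [Fintype ι] : Measure (PureState ι) :=
  ((volume : Measure (EuclideanSpace ℂ ι)).toSphere Set.univ)⁻¹ •
    (volume : Measure (EuclideanSpace ℂ ι)).toSphere

instance haarState_isProbabilityMeasure (ι : Type) [Fintype ι] [Nonempty ι] :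
    IsProbabilityMeasure (haarState ι) := by
  constructor
  have h0 : (volume : Measure (EuclideanSpace ℂ ι)).toSphere Set.univ ≠ 0 := by
    rw [Ne, Measure.measure_univ_eq_zero]
    exact Measure.toSphere_ne_zero _
  rw [haarState, Measure.smul_apply, smul_eq_mul]
  exact ENNReal.inv_mul_cancel h0 (measure_ne_top _ _)

/-- The density matrix `|ψ⟩⟨ψ|` of a pure state. -/
def density {ι : Type} [Fintype ι] (ψ : PureState ι) : Matrix ι ι ℂ :=
  Matrix.of fun x y => ψ.1 x * star (ψ.1 y)

/-- The `t`-fold tensor power of a matrix, acting on `t` registers. -/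
def tensorPow {ι : Type} (A : Matrix ι ι ℂ) (t : ℕ) : Matrix (Fin t → ι) (Fin t → ι) ℂ :=
  Matrix.of fun x y => ∏ i, A (x i) (y i)

/-- The expectation (entry by entry) of a matrix depending on a Haar random state. -/
def haarExp {ι κ : Type} [Fintype ι] (M : PureState ι → Matrix κ κ ℂ) : Matrix κ κ ℂ :=
  Matrix.of fun x y => ∫ ψ, M ψ x y ∂(haarState ι)

/-- The average of a matrix over a uniformly random key `k ∈ {0,1}^n`. -/
def keyExp {κ : Type} {n : ℕ} (M : (Fin n → Bool) → Matrix κ κ ℂ) : Matrix κ κ ℂ :=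
  ((2 : ℂ) ^ n)⁻¹ • ∑ k, M k

/-- The maximally mixed state `I / 2^m` of `m` qubits. -/
def maxMixed (m : ℕ) : Matrix (Qubits m) (Qubits m) ℂ :=
  ((2 : ℂ) ^ m)⁻¹ • (1 : Matrix (Qubits m) (Qubits m) ℂ)

/-- The trace norm `Tr √(Aᴴ A)`, i.e. the sum of the singular values of `A`. -/
def traceNorm {κ : Type} [Fintype κ] [DecidableEq κ] (A : Matrix κ κ ℂ) : ℝ :=
  ∑ i, Real.sqrt ((isHermitian_conjTranspose_mul_self A).eigenvalues i)

/-- Splitting `m ≥ 1` qubits into the first qubit and the last `m - 1` qubits. -/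
def splitFirst {m : ℕ} (hm : 0 < m) : Qubits m ≃ Fin 2 × Qubits (m - 1) where
  toFun x := (x ⟨0, hm⟩, fun i => x ⟨i.1 + 1, by omega⟩)
  invFun p := fun j => if h : j.1 = 0 then p.1 else p.2 ⟨j.1 - 1, by omega⟩
  left_inv x := by
    funext j
    by_cases h : j.1 = 0
    · simp only [h, dite_true]
      congr 1
      exact Fin.ext h.symm
    · simp only [h, dite_false]
      congr 1
      exact Fin.ext (by simp only; omega)
  right_inv p := by
    refine Prod.ext ?_ ?_
    · simp
    · funext i
      simp

/-- The operator `I ⊗ U` on `m` qubits, where `U` acts on the last `m - 1` qubits. -/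
def idTensor {m : ℕ} (hm : 0 < m) (U : Matrix (Qubits (m - 1)) (Qubits (m - 1)) ℂ) :
    Matrix (Qubits m) (Qubits m) ℂ :=
  ((1 : Matrix (Fin 2) (Fin 2) ℂ) ⊗ₖ U).submatrix (splitFirst hm) (splitFirst hm)

/-- For a family `V` of `m`-qubit operators, the trace norm of
`E_k E_ψ (V_k ψ V_kᴴ) ⊗ ψ^{⊗ t} - E_ψ (I / 2^m) ⊗ ψ^{⊗ t}`,
where `ψ` is the density matrix of a Haar random `m`-qubit state and `k` is uniform. -/
def distFromMixed {m n : ℕ} (V : (Fin n → Bool) → Matrix (Qubits m) (Qubits m) ℂ) (t : ℕ) : ℝ :=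
  traceNorm
    (keyExp (fun k => haarExp fun ψ : PureState (Qubits m) =>
        (V k * density ψ * (V k)ᴴ) ⊗ₖ tensorPow (density ψ) t) -
      haarExp fun ψ : PureState (Qubits m) => maxMixed m ⊗ₖ tensorPow (density ψ) t)

end

/-! Let `D` be the dimension of the last `m - 1` qubits, `t = r - 1`, and `ε` the trace norm on the
right-hand side. Haar averages are replaced by Gaussian ones: for integrands homogeneous of degree
`2p` the two differ only by the radial moment, and consecutive moments in dimension `d` have ratio
`d + p` (`gaussianMoment_succ`). The gain is that a Gaussian vector on a qubit and a system splits
as `|0⟩ ⊗ x + |1⟩ ⊗ y` with `x`, `y` independent Gaussians in dimension `D`.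

Project the first register of the large difference operator on `|0⟩`. What remains is the integral
of `(E_k U_k |x⟩⟨x| U_kᴴ - c) ⊗ (|0⟩x + |1⟩y)^{⊗ t}` (the second factor as a projector) with `c = 1
+ t / (2D)`. Expand the tensor power by the number `j` of registers holding `x`. Phase invariance of
`x` kills the terms with different `j` in ket and bra. Each surviving term is, up to conjugation by
an operator depending on `y`, the small difference operator with `j ≤ t` copies, plus an error
proportional to `j - t/2`; discarding copies cannot increase the trace norm. The symmetry `j ↔ t -
j` turns the weights `D + j` into `D + t/2`, half of the large normalisation `2D + t`. Hence the
block has trace norm at most `ε/2 + t / (2 · 2^m)` (`traceNorm_qubitBlock_defect_le`).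

Since `I ⊗ U_k` commutes with rotations of the qubit, the same bound holds for the diagonal block
along any unit vector of the qubit. Polarization bounds each off-diagonal block by twice as much, so
the four blocks cost a factor `1 + 1 + 2 + 2 = 6` (`traceNorm_defect_le_six_mul`). The outcome `3ε +
3t / 2^m` is below the stated bound. -/

/-! ### Trace norm and its duality with unitaries -/

section TraceNorm

open scoped Matrix.Norms.L2Operator

variable {κ κ' : Type} [Fintype κ] [DecidableEq κ] [Fintype κ'] [DecidableEq κ']

theorem trace_eq_sum_inner_toEuclideanCLM {ν : Type*} [Fintype ν] (A : Matrix κ κ ℂ)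
    (b : OrthonormalBasis ν ℂ (EuclideanSpace ℂ κ)) :
    A.trace = ∑ i, inner ℂ (b i) (toEuclideanCLM (n := κ) (𝕜 := ℂ) A (b i)) := by
  have h := LinearMap.trace_eq_sum_inner (toEuclideanLin A) b
  rw [toEuclideanLin_eq_toLin_orthonormal, Matrix.trace_toLin_eq] at h
  rw [h]
  rfl

theorem inner_apply_eigenvectorBasis (A : Matrix κ κ ℂ) (i j : κ) :
    inner ℂ (toEuclideanCLM (n := κ) (𝕜 := ℂ) A
        ((isHermitian_conjTranspose_mul_self A).eigenvectorBasis i))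
      (toEuclideanCLM (n := κ) (𝕜 := ℂ) A
        ((isHermitian_conjTranspose_mul_self A).eigenvectorBasis j)) =
      if i = j then ((isHermitian_conjTranspose_mul_self A).eigenvalues j : ℂ) else 0 := by
  set hA := isHermitian_conjTranspose_mul_self A
  rw [← ContinuousLinearMap.adjoint_inner_right, ← ContinuousLinearMap.star_eq_adjoint,
    ← map_star, ← mul_apply_eq_comp, ← map_mul]
  have h : toEuclideanCLM (n := κ) (𝕜 := ℂ) (star A * A) (hA.eigenvectorBasis j) =
      (hA.eigenvalues j : ℂ) • hA.eigenvectorBasis j := by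
    apply (WithLp.ofLp_injective 2)
    rw [ofLp_toEuclideanCLM]
    have := hA.mulVec_eigenvectorBasis j
    rw [star_eq_conjTranspose, this]
    ext x
    simp
  rw [h, inner_smul_right, orthonormal_iff_ite.mp hA.eigenvectorBasis.orthonormal i j]
  split_ifs <;> simp

theorem norm_apply_eigenvectorBasis (A : Matrix κ κ ℂ) (i : κ) :
    ‖toEuclideanCLM (n := κ) (𝕜 := ℂ) A
        ((isHermitian_conjTranspose_mul_self A).eigenvectorBasis i)‖ =
      √((isHermitian_conjTranspose_mul_self A).eigenvalues i) := by
  rw [@norm_eq_sqrt_re_inner ℂ, inner_apply_eigenvectorBasis]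
  simp

theorem norm_trace_mul_le (B A : Matrix κ κ ℂ) : ‖(B * A).trace‖ ≤ ‖B‖ * traceNorm A := by
  set hA := isHermitian_conjTranspose_mul_self A
  rw [trace_eq_sum_inner_toEuclideanCLM _ hA.eigenvectorBasis, traceNorm, Finset.mul_sum]
  refine (norm_sum_le _ _).trans (Finset.sum_le_sum fun i _ => ?_)
  refine (norm_inner_le_norm _ _).trans ?_
  rw [hA.eigenvectorBasis.orthonormal.1 i, one_mul, map_mul, mul_apply_eq_comp]
  refine (ContinuousLinearMap.le_opNorm _ _).trans ?_
  rw [l2_opNorm_toEuclideanCLM, norm_apply_eigenvectorBasis]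

/-- Polar decomposition: `A` maps the eigenbasis of `Aᴴ A` to orthogonal vectors whose lengths are
the singular values, and `W` rotates their directions back to the eigenbasis. -/
theorem exists_unitary_trace_mul_eq_traceNorm (A : Matrix κ κ ℂ) :
    ∃ W ∈ unitaryGroup κ ℂ, (W * A).trace = traceNorm A := by
  set hA := isHermitian_conjTranspose_mul_self A with hA'
  set b := hA.eigenvectorBasis with hb
  set f := toEuclideanCLM (n := κ) (𝕜 := ℂ) with hf
  set s : κ → ℝ := fun i => √(hA.eigenvalues i) with hs
  have hpos : ∀ i, 0 ≤ hA.eigenvalues i := eigenvalues_conjTranspose_mul_self_nonneg A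
  have hss : ∀ i, ((s i : ℂ)) * s i = hA.eigenvalues i := fun i => by
    rw [← Complex.ofReal_mul, Real.mul_self_sqrt (hpos i)]
  let u : κ → EuclideanSpace ℂ κ := fun i => (s i : ℂ)⁻¹ • f A (b i)
  have hu : Orthonormal ℂ (({i | s i ≠ 0} : Set κ).domRestrict u) := by
    rw [orthonormal_iff_ite]
    rintro ⟨i, hi⟩ ⟨j, hj⟩
    simp only [Set.domRestrict_apply, u, inner_smul_left, inner_smul_right, Subtype.mk.injEq]
    rw [inner_apply_eigenvectorBasis]
    split_ifs with h
    · subst h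
      rw [← hss]
      have : (s i : ℂ) ≠ 0 := by exact_mod_cast hi
      simp
      field_simp
    · simp
  -- Only nonzero singular values determine a direction; the other members of `c` are arbitrary,
  -- which is harmless because they are multiplied by `0`.
  obtain ⟨c, hc⟩ := hu.exists_orthonormalBasis_extension_of_card_eq (by simp)
  have hAb : ∀ i, f A (b i) = (s i : ℂ) • c i := fun i => by
    by_cases h : s i = 0
    · have : ‖f A (b i)‖ = 0 := (norm_apply_eigenvectorBasis A i).trans h
      rw [h, norm_eq_zero.mp this]; simp
    · rw [hc i h]
      have : (s i : ℂ) ≠ 0 := by exact_mod_cast h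
      simp [u, smul_smul, this]
  let e : EuclideanSpace ℂ κ ≃ₗᵢ[ℂ] EuclideanSpace ℂ κ := c.equiv b (Equiv.refl κ)
  refine ⟨f.symm (e : EuclideanSpace ℂ κ →L[ℂ] EuclideanSpace ℂ κ), ?_, ?_⟩
  · rw [mem_unitaryGroup_iff']
    refine (EmbeddingLike.injective f) ?_
    rw [map_mul, map_star, StarAlgEquiv.apply_symm_apply, map_one,
      ContinuousLinearMap.star_eq_adjoint]
    ext1 x
    refine ext_inner_left ℂ fun y => ?_
    rw [mul_apply_eq_comp, ContinuousLinearMap.adjoint_inner_right]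
    exact e.inner_map_map y x
  · rw [trace_eq_sum_inner_toEuclideanCLM _ b, traceNorm, Complex.ofReal_sum]
    refine Finset.sum_congr rfl fun i _ => ?_
    rw [map_mul, mul_apply_eq_comp, ← hf, StarAlgEquiv.apply_symm_apply, hAb, map_smul]
    have : (e : EuclideanSpace ℂ κ →L[ℂ] EuclideanSpace ℂ κ) (c i) = b i := by
      simp [e]
    rw [this, inner_smul_right, inner_self_eq_norm_sq_to_K, b.orthonormal.1 i]
    simp [hs]

theorem l2_opNorm_le_one_of_mem_unitaryGroup {W : Matrix κ κ ℂ} (hW : W ∈ unitaryGroup κ ℂ) :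
    ‖W‖ ≤ 1 := by
  have h := l2_opNorm_conjTranspose_mul_self W
  rw [← star_eq_conjTranspose, mem_unitaryGroup_iff'.mp hW] at h
  have h1 : ‖(1 : Matrix κ κ ℂ)‖ ≤ 1 := by
    rw [← l2_opNorm_toEuclideanCLM, map_one]
    exact ContinuousLinearMap.norm_id_le
  nlinarith [norm_nonneg W]

theorem traceNorm_nonneg (A : Matrix κ κ ℂ) : 0 ≤ traceNorm A :=
  Finset.sum_nonneg fun _ _ => Real.sqrt_nonneg _

theorem norm_trace_mul_le_traceNorm {W : Matrix κ κ ℂ} (hW : W ∈ unitaryGroup κ ℂ)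
    (A : Matrix κ κ ℂ) : ‖(W * A).trace‖ ≤ traceNorm A :=
  (norm_trace_mul_le W A).trans
    (mul_le_of_le_one_left (traceNorm_nonneg A) (l2_opNorm_le_one_of_mem_unitaryGroup hW))

/-- With `norm_trace_mul_le_traceNorm` this says that the trace norm is a supremum over unitaries of
a linear functional. The norm inequalities below are derived from this form. -/
theorem traceNorm_le_of_forall_unitary {A : Matrix κ κ ℂ} {c : ℝ}
    (h : ∀ W ∈ unitaryGroup κ ℂ, ‖(W * A).trace‖ ≤ c) : traceNorm A ≤ c := by
  obtain ⟨W, hW, hWA⟩ := exists_unitary_trace_mul_eq_traceNorm A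
  have := h W hW
  rwa [hWA, Complex.norm_real, Real.norm_of_nonneg (traceNorm_nonneg A)] at this

theorem traceNorm_sum_le {ν : Type*} (s : Finset ν) (A : ν → Matrix κ κ ℂ) :
    traceNorm (∑ i ∈ s, A i) ≤ ∑ i ∈ s, traceNorm (A i) := by
  refine traceNorm_le_of_forall_unitary fun W hW => ?_
  rw [Matrix.mul_sum, trace_sum]
  exact (norm_sum_le _ _).trans (Finset.sum_le_sum fun i _ => norm_trace_mul_le_traceNorm hW _)

theorem traceNorm_add_le (A B : Matrix κ κ ℂ) : traceNorm (A + B) ≤ traceNorm A + traceNorm B := by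
  refine traceNorm_le_of_forall_unitary fun W hW => ?_
  rw [Matrix.mul_add, trace_add]
  exact (norm_add_le _ _).trans
    (add_le_add (norm_trace_mul_le_traceNorm hW _) (norm_trace_mul_le_traceNorm hW _))

theorem traceNorm_smul_le (c : ℂ) (A : Matrix κ κ ℂ) :
    traceNorm (c • A) ≤ ‖c‖ * traceNorm A := by
  refine traceNorm_le_of_forall_unitary fun W hW => ?_
  rw [Matrix.mul_smul, trace_smul, norm_smul]
  exact mul_le_mul_of_nonneg_left (norm_trace_mul_le_traceNorm hW _) (norm_nonneg c)

theorem traceNorm_smul (c : ℂ) (A : Matrix κ κ ℂ) :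
    traceNorm (c • A) = ‖c‖ * traceNorm A := by
  refine le_antisymm (traceNorm_smul_le c A) ?_
  rcases eq_or_ne c 0 with rfl | hc
  · simpa using traceNorm_nonneg _
  · have h := traceNorm_smul_le c⁻¹ (c • A)
    rw [smul_smul, inv_mul_cancel₀ hc, one_smul, norm_inv] at h
    have : 0 < ‖c‖ := norm_pos_iff.mpr hc
    rwa [le_inv_mul_iff₀ this] at h

theorem traceNorm_mul_mul_le (L : Matrix κ' κ ℂ) (A : Matrix κ κ ℂ) (R : Matrix κ κ' ℂ) :
    traceNorm (L * A * R) ≤ ‖L‖ * ‖R‖ * traceNorm A := by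
  refine traceNorm_le_of_forall_unitary fun W hW => ?_
  rw [show (W * (L * A * R)).trace = (R * (W * L) * A).trace by
    rw [← Matrix.mul_assoc, Matrix.trace_mul_comm]
    simp only [Matrix.mul_assoc]]
  refine (norm_trace_mul_le _ A).trans (mul_le_mul_of_nonneg_right ?_ (traceNorm_nonneg A))
  calc ‖R * (W * L)‖ ≤ ‖R‖ * ‖W * L‖ := l2_opNorm_mul _ _
    _ ≤ ‖R‖ * (‖W‖ * ‖L‖) := by gcongr; exact l2_opNorm_mul _ _
    _ ≤ ‖R‖ * (1 * ‖L‖) := by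
      gcongr; exact l2_opNorm_le_one_of_mem_unitaryGroup hW
    _ = ‖L‖ * ‖R‖ := by ring

omit [DecidableEq κ'] in
theorem l2_opNorm_mul_self_le {L : Matrix κ' κ ℂ} {c : ℝ} (hc : 0 ≤ c)
    (hL : Lᴴ * L = (c : ℂ) • (1 : Matrix κ κ ℂ)) : ‖L‖ * ‖L‖ ≤ c := by
  rw [← l2_opNorm_conjTranspose_mul_self, hL, norm_smul, Complex.norm_real, Real.norm_of_nonneg hc]
  exact mul_le_of_le_one_right hc (l2_opNorm_le_one_of_mem_unitaryGroup (one_mem _))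

theorem traceNorm_conj_le {L : Matrix κ' κ ℂ} {c : ℝ} (hc : 0 ≤ c)
    (hL : Lᴴ * L = (c : ℂ) • (1 : Matrix κ κ ℂ)) (A : Matrix κ κ ℂ) :
    traceNorm (L * A * Lᴴ) ≤ c * traceNorm A := by
  refine (traceNorm_mul_mul_le L A Lᴴ).trans ?_
  rw [l2_opNorm_conjTranspose]
  exact mul_le_mul_of_nonneg_right (l2_opNorm_mul_self_le hc hL) (traceNorm_nonneg A)

/-- Conjugation by a coisometry does not increase the trace norm. -/
theorem traceNorm_mul_mul_conjTranspose_le_of_coisometry {L R : Matrix κ κ' ℂ}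
    (hL : L * Lᴴ = 1) (hR : R * Rᴴ = 1) (A : Matrix κ κ ℂ) :
    traceNorm (Lᴴ * A * R) ≤ traceNorm A := by
  have key : ∀ {L : Matrix κ κ' ℂ}, L * Lᴴ = 1 → ‖L‖ ≤ 1 := fun {L} hL => by
    have h := l2_opNorm_mul_self_le (L := Lᴴ) (c := 1) zero_le_one (by simpa using hL)
    rw [l2_opNorm_conjTranspose] at h
    nlinarith [norm_nonneg L]
  refine (traceNorm_mul_mul_le _ A _).trans ?_
  rw [l2_opNorm_conjTranspose]
  refine mul_le_of_le_one_left (traceNorm_nonneg A) ?_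
  exact mul_le_one₀ (key hL) (norm_nonneg _) (key hR)

theorem traceNorm_one_le : traceNorm (1 : Matrix κ κ ℂ) ≤ Fintype.card κ := by
  refine traceNorm_le_of_forall_unitary fun W hW => ?_
  rw [Matrix.mul_one, Matrix.trace]
  refine (norm_sum_le _ _).trans ?_
  refine (Finset.sum_le_sum fun i _ => entry_norm_bound_of_unitary hW i i).trans ?_
  simp

theorem traceNorm_submatrix_equiv_le (A : Matrix κ κ ℂ) (e : κ' ≃ κ) :
    traceNorm (A.submatrix e e) ≤ traceNorm A := by
  refine traceNorm_le_of_forall_unitary fun W hW => ?_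
  have h : (W * A.submatrix e e).trace = (W.submatrix e.symm e.symm * A).trace := by
    have : W * A.submatrix e e = (W.submatrix e.symm e.symm * A).submatrix e e := by
      rw [Matrix.submatrix_mul_equiv (W.submatrix e.symm e.symm) A e e e |>.symm]
      simp
    rw [this]
    exact Equiv.sum_comp e fun i => (W.submatrix e.symm e.symm * A) i i
  rw [h]
  refine norm_trace_mul_le_traceNorm ?_ A
  rw [mem_unitaryGroup_iff] at hW ⊢
  rw [star_eq_conjTranspose] at hW ⊢
  rw [conjTranspose_submatrix, submatrix_mul_equiv, hW, submatrix_one_equiv]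

/-- The partial trace over the second factor does not increase the trace norm. -/
theorem traceNorm_partialTrace_le (A : Matrix (κ × κ') (κ × κ') ℂ) :
    traceNorm (Matrix.of fun x y => ∑ q, A (x, q) (y, q)) ≤ traceNorm A := by
  refine traceNorm_le_of_forall_unitary fun W hW => ?_
  -- The partial trace is dual to `W ↦ W ⊗ 1`, which preserves unitarity.
  have h : (W * (Matrix.of fun x y => ∑ q, A (x, q) (y, q))).trace =
      ((W ⊗ₖ (1 : Matrix κ' κ' ℂ)) * A).trace := by
    simp only [Matrix.trace, Matrix.diag_apply, Matrix.mul_apply, Matrix.of_apply,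
      Fintype.sum_prod_type, kroneckerMap_apply, Matrix.one_apply, Finset.mul_sum]
    refine Finset.sum_congr rfl fun x _ => ?_
    rw [Finset.sum_comm]
    refine Finset.sum_congr rfl fun q _ => Finset.sum_congr rfl fun y _ => ?_
    simp
  rw [h]
  exact norm_trace_mul_le_traceNorm (kronecker_mem_unitary hW (one_mem _)) A

end TraceNorm

/-! ### Entrywise integrals of matrix-valued functions -/

section MatrixIntegral

variable {κ κ' Ω : Type} [MeasurableSpace Ω]

/-- The entrywise integral of a matrix-valued function. -/
noncomputable def matInt (μ : Measure Ω) (M : Ω → Matrix κ κ' ℂ) : Matrix κ κ' ℂ :=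
  Matrix.of fun x y => ∫ ω, M ω x y ∂μ

/-- Integrability of all the entries of a matrix-valued function. -/
def MatIntegrable (μ : Measure Ω) (M : Ω → Matrix κ κ' ℂ) : Prop :=
  ∀ x y, Integrable (fun ω => M ω x y) μ

variable {μ : Measure Ω} {M N : Ω → Matrix κ κ' ℂ}

theorem MatIntegrable.sum {ν : Type*} {s : Finset ν} {M : ν → Ω → Matrix κ κ' ℂ}
    (hM : ∀ i ∈ s, MatIntegrable μ (M i)) : MatIntegrable μ fun ω => ∑ i ∈ s, M i ω := by
  intro x y
  simp only [Matrix.sum_apply]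
  exact integrable_finsetSum _ fun i hi => hM i hi x y

theorem matInt_sub (hM : MatIntegrable μ M) (hN : MatIntegrable μ N) :
    matInt μ (fun ω => M ω - N ω) = matInt μ M - matInt μ N := by
  ext x y
  exact integral_sub (hM x y) (hN x y)

theorem matInt_smul (c : ℂ) : matInt μ (fun ω => c • M ω) = c • matInt μ M := by
  ext x y
  exact integral_const_mul c _

theorem matInt_sum {ν : Type*} {s : Finset ν} {M : ν → Ω → Matrix κ κ' ℂ}
    (hM : ∀ i ∈ s, MatIntegrable μ (M i)) :
    matInt μ (fun ω => ∑ i ∈ s, M i ω) = ∑ i ∈ s, matInt μ (M i) := by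
  ext x y
  simp only [matInt, Matrix.of_apply, Matrix.sum_apply]
  exact integral_finsetSum _ fun i hi => hM i hi x y

theorem MatIntegrable.mul_mul {σ τ : Type} [Fintype κ] [Fintype κ'] (hM : MatIntegrable μ M)
    (L : Matrix σ κ ℂ) (R : Matrix κ' τ ℂ) : MatIntegrable μ fun ω => L * M ω * R := by
  intro x y
  simp only [Matrix.mul_apply]
  exact integrable_finsetSum _ fun j _ =>
    (integrable_finsetSum _ fun i _ => (hM i j).const_mul _).mul_const _

theorem matInt_mul_mul {σ τ : Type} [Fintype κ] [Fintype κ'] (hM : MatIntegrable μ M)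
    (L : Matrix σ κ ℂ) (R : Matrix κ' τ ℂ) :
    matInt μ (fun ω => L * M ω * R) = L * matInt μ M * R := by
  ext x y
  simp only [Matrix.mul_apply, matInt, Matrix.of_apply]
  rw [integral_finsetSum _ fun j _ =>
    (integrable_finsetSum _ fun i _ => (hM i j).const_mul _).mul_const _]
  refine Finset.sum_congr rfl fun j _ => ?_
  rw [integral_mul_const, integral_finsetSum _ fun i _ => (hM i j).const_mul _]
  congr 1
  exact Finset.sum_congr rfl fun i _ => integral_const_mul _ _

theorem traceNorm_matInt_le [Fintype κ] [DecidableEq κ] {M : Ω → Matrix κ κ ℂ} {f : Ω → ℝ}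
    (hM : MatIntegrable μ M) (hf : Integrable f μ) (h : ∀ ω, traceNorm (M ω) ≤ f ω) :
    traceNorm (matInt μ M) ≤ ∫ ω, f ω ∂μ := by
  refine traceNorm_le_of_forall_unitary fun W hW => ?_
  have h1 : (W * matInt μ M).trace = ∫ ω, (W * M ω).trace ∂μ := by
    simp only [Matrix.trace, Matrix.diag_apply, Matrix.mul_apply, matInt, Matrix.of_apply]
    refine Eq.symm ((integral_finsetSum _ fun i _ =>
      integrable_finsetSum _ fun j _ => (hM j i).const_mul _).trans ?_)
    refine Finset.sum_congr rfl fun i _ => ?_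
    refine (integral_finsetSum _ fun j _ => (hM j i).const_mul _).trans ?_
    exact Finset.sum_congr rfl fun j _ => integral_const_mul _ _
  rw [h1]
  exact norm_integral_le_of_norm_le hf
    (Filter.Eventually.of_forall fun ω => (norm_trace_mul_le_traceNorm hW _).trans (h ω))

end MatrixIntegral

/-! ### Gaussian measure, its moments, and comparison with Haar measure -/

section Gaussian

variable {ι κ : Type} [Fintype ι] [Fintype κ]

/-- The unnormalised Gaussian measure `exp (-‖x‖²) dx` on `ℂ^ι`. -/
noncomputable def gaussian (ι : Type) [Fintype ι] : Measure (EuclideanSpace ℂ ι) :=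
  (volume : Measure (EuclideanSpace ℂ ι)).withDensity fun x => ENNReal.ofReal (Real.exp (-‖x‖ ^ 2))

/-- The moment `∫ ‖x‖^(2p)` of the Gaussian measure. -/
noncomputable def gaussianMoment (ι : Type) [Fintype ι] (p : ℕ) : ℝ :=
  ∫ x : EuclideanSpace ℂ ι, ‖x‖ ^ (2 * p) ∂(gaussian ι)

/-- Continuous functions that are homogeneous of degree `n` under nonnegative scaling. -/
structure HomogCont (n : ℕ) (F : EuclideanSpace ℂ ι → ℂ) : Prop where
  continuous : Continuous F
  map_smul : ∀ r : ℝ, 0 ≤ r → ∀ x, F (r • x) = (r : ℂ) ^ n * F x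

theorem measurable_exp_neg_norm_sq :
    Measurable fun x : EuclideanSpace ℂ ι => ENNReal.ofReal (Real.exp (-‖x‖ ^ 2)) := by
  fun_prop

theorem integral_gaussian_eq {F : Type*} [NormedAddCommGroup F] [NormedSpace ℝ F]
    (f : EuclideanSpace ℂ ι → F) :
    ∫ x, f x ∂(gaussian ι) = ∫ x, Real.exp (-‖x‖ ^ 2) • f x := by
  rw [gaussian, integral_withDensity_eq_integral_toReal_smul measurable_exp_neg_norm_sq
    (Filter.Eventually.of_forall fun _ => ENNReal.ofReal_lt_top)]
  simp only [ENNReal.toReal_ofReal (Real.exp_nonneg _)]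

theorem integrable_gaussian_iff {f : EuclideanSpace ℂ ι → ℝ} :
    Integrable f (gaussian ι) ↔ Integrable fun x => Real.exp (-‖x‖ ^ 2) * f x := by
  rw [gaussian, integrable_withDensity_iff_integrable_smul' measurable_exp_neg_norm_sq
    (Filter.Eventually.of_forall fun _ => ENNReal.ofReal_lt_top)]
  simp only [ENNReal.toReal_ofReal (Real.exp_nonneg _), smul_eq_mul]

theorem finrank_real_euclideanSpace_complex :
    Module.finrank ℝ (EuclideanSpace ℂ ι) = 2 * Fintype.card ι := by
  rw [finrank_real_of_complex, finrank_euclideanSpace]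

theorem integrableOn_pow_mul_exp_neg_sq (n : ℕ) :
    IntegrableOn (fun y : ℝ => y ^ n * Real.exp (-y ^ 2)) (Set.Ioi 0) := by
  have h := integrableOn_rpow_mul_exp_neg_rpow (s := n) (p := 2)
    (by have : (0 : ℝ) ≤ n := n.cast_nonneg
        linarith) two_pos
  refine h.congr_fun (fun y _ => ?_) measurableSet_Ioi
  simp

theorem integral_pow_mul_exp_neg_sq (n : ℕ) :
    ∫ y in Set.Ioi (0 : ℝ), y ^ n * Real.exp (-y ^ 2) = 1 / 2 * Real.Gamma ((n + 1) / 2) := by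
  have h := integral_rpow_mul_exp_neg_rpow (q := n) (p := 2) two_pos
    (by have : (0 : ℝ) ≤ n := n.cast_nonneg
        linarith)
  rw [← h]
  refine setIntegral_congr_fun measurableSet_Ioi (fun y _ => ?_)
  simp

theorem integrable_norm_pow_gaussian [Nonempty ι] (n : ℕ) :
    Integrable (fun x : EuclideanSpace ℂ ι => ‖x‖ ^ n) (gaussian ι) := by
  rw [integrable_gaussian_iff]
  refine (integrable_fun_norm_addHaar (E := EuclideanSpace ℂ ι) volume
    (f := fun y => Real.exp (-y ^ 2) * y ^ n)).mpr ?_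
  refine (integrableOn_pow_mul_exp_neg_sq
    (Module.finrank ℝ (EuclideanSpace ℂ ι) - 1 + n)).congr_fun (fun y _ => ?_) measurableSet_Ioi
  simp only [smul_eq_mul, pow_add]
  ring

instance [Nonempty ι] : IsFiniteMeasure (gaussian ι) := by
  have h := integrable_norm_pow_gaussian (ι := ι) 0
  simp only [pow_zero] at h
  exact (integrable_const_iff_isFiniteMeasure one_ne_zero).mp h

/-- Polar coordinates in real dimension `2 * Fintype.card ι`. The volume factor plays no role later:
only positivity and the ratio of consecutive moments are used. -/
theorem gaussianMoment_eq [Nonempty ι] (p : ℕ) :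
    gaussianMoment ι p = 2 * Fintype.card ι *
      (volume : Measure (EuclideanSpace ℂ ι)).real (Metric.ball 0 1) *
      (1 / 2 * Real.Gamma (Fintype.card ι + p)) := by
  have h := integral_fun_norm_addHaar (E := EuclideanSpace ℂ ι) volume
    (fun y : ℝ => Real.exp (-y ^ 2) * y ^ (2 * p))
  rw [gaussianMoment, integral_gaussian_eq]
  simp only [smul_eq_mul] at h ⊢
  rw [h, finrank_real_euclideanSpace_complex]
  have hc : 1 ≤ Fintype.card ι := Fintype.card_pos
  have h2 := integral_pow_mul_exp_neg_sq (2 * Fintype.card ι - 1 + 2 * p)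
  have h3 : ((2 * Fintype.card ι - 1 + 2 * p : ℕ) + 1 : ℝ) / 2 = Fintype.card ι + p := by
    rw [Nat.cast_add, Nat.cast_sub (by omega)]
    push_cast
    ring
  rw [h3] at h2
  rw [← h2, nsmul_eq_mul]
  push_cast
  rw [← mul_assoc]
  congr 1
  refine setIntegral_congr_fun measurableSet_Ioi fun y _ => ?_
  simp only [pow_add]
  ring

theorem gaussianMoment_pos [Nonempty ι] (p : ℕ) : 0 < gaussianMoment ι p := by
  rw [gaussianMoment_eq]
  have hc : (0 : ℝ) < Fintype.card ι := by exact_mod_cast Fintype.card_pos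
  have hG : 0 < Real.Gamma (Fintype.card ι + p) := Real.Gamma_pos_of_pos (by positivity)
  have hb : 0 < (volume : Measure (EuclideanSpace ℂ ι)).real (Metric.ball 0 1) :=
    ENNReal.toReal_pos (Metric.measure_ball_pos _ _ one_pos).ne' measure_ball_lt_top.ne
  positivity

theorem gaussianMoment_succ [Nonempty ι] (p : ℕ) :
    gaussianMoment ι (p + 1) = (Fintype.card ι + p) * gaussianMoment ι p := by
  have hc : (0 : ℝ) < Fintype.card ι := by exact_mod_cast Fintype.card_pos
  rw [gaussianMoment_eq, gaussianMoment_eq]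
  push_cast
  rw [← add_assoc, Real.Gamma_add_one (by positivity)]
  ring

namespace HomogCont

variable {n p : ℕ} {F G : EuclideanSpace ℂ ι → ℂ}

theorem exists_bound (hF : HomogCont n F) : ∃ C : ℝ, ∀ x, ‖F x‖ ≤ C * ‖x‖ ^ n := by
  obtain ⟨C, hC⟩ := (isCompact_sphere (0 : EuclideanSpace ℂ ι) 1).exists_bound_of_continuousOn
    hF.continuous.continuousOn
  -- For empty `ι` the unit sphere is empty and gives no information at the only point `0`.
  rcases isEmpty_or_nonempty ι with hι | hι
  · refine ⟨‖F 0‖, fun x => ?_⟩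
    have hx : x = 0 := Subsingleton.elim _ _
    subst hx
    rcases Nat.eq_zero_or_pos n with rfl | hn
    · simp
    · have := hF.map_smul 0 le_rfl 0
      simp [hn.ne'] at this
      simp [this]
  refine ⟨C, fun x => ?_⟩
  rcases eq_or_ne x 0 with rfl | hx
  · obtain ⟨y, hy⟩ := (NormedSpace.sphere_nonempty (E := EuclideanSpace ℂ ι) (x := 0)
      (r := 1)).mpr zero_le_one
    have h0 := hF.map_smul 0 le_rfl y
    rw [zero_smul] at h0
    rw [h0, norm_mul, norm_zero, norm_pow]
    simp only [Complex.ofReal_zero, norm_zero]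
    rw [mul_comm]
    gcongr
    exact hC y hy
  · have hx' : ‖x‖ ≠ 0 := norm_ne_zero_iff.mpr hx
    have h1 : x = ‖x‖ • (‖x‖⁻¹ • x) := by rw [smul_smul, mul_inv_cancel₀ hx', one_smul]
    have h2 : ‖x‖⁻¹ • x ∈ Metric.sphere (0 : EuclideanSpace ℂ ι) 1 := by
      simp [norm_smul, hx']
    have h3 : ‖F x‖ = ‖x‖ ^ n * ‖F (‖x‖⁻¹ • x)‖ := by
      conv_lhs => rw [h1, hF.map_smul _ (norm_nonneg x)]
      simp
    rw [h3, mul_comm]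
    gcongr
    exact hC _ h2

theorem integrable [Nonempty ι] (hF : HomogCont n F) : Integrable F (gaussian ι) := by
  obtain ⟨C, hC⟩ := hF.exists_bound
  exact ((integrable_norm_pow_gaussian n).const_mul C).mono'
    hF.continuous.aestronglyMeasurable (Filter.Eventually.of_forall hC)

/-- Polar coordinates separate the integral; the radial factor depends on `F` only through its
degree. -/
theorem integral_eq [Nonempty ι] (hF : HomogCont n F) :
    ∫ x, F x ∂(gaussian ι) =
      (∫ θ : PureState ι, F θ ∂(volume : Measure (EuclideanSpace ℂ ι)).toSphere) *
      ∫ r : Set.Ioi (0 : ℝ), ((Real.exp (-r.1 ^ 2) * r.1 ^ n : ℝ) : ℂ)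
        ∂(Measure.volumeIoiPow (Module.finrank ℝ (EuclideanSpace ℂ ι) - 1)) := by
  rw [integral_gaussian_eq, ← integral_prod_mul,
    ← (Measure.measurePreserving_homeomorphUnitSphereProd
      (volume : Measure (EuclideanSpace ℂ ι))).integral_comp (Homeomorph.measurableEmbedding _)]
  have h := integral_subtype_comap (μ := (volume : Measure (EuclideanSpace ℂ ι)))
    (measurableSet_singleton (0 : EuclideanSpace ℂ ι)).compl
    fun x => Real.exp (-‖x‖ ^ 2) • F x
  rw [restrict_compl_singleton] at h
  rw [← h]
  congr 1
  funext x
  have hx' : ‖x.1‖ ≠ 0 := norm_ne_zero_iff.mpr x.2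
  simp only [homeomorphUnitSphereProd_apply_fst_coe, homeomorphUnitSphereProd_apply_snd_coe]
  rw [hF.map_smul _ (inv_nonneg.mpr (norm_nonneg _)), Complex.real_smul]
  push_cast
  have h1 : (‖x.1‖ : ℂ) ≠ 0 := by exact_mod_cast hx'
  rw [inv_pow]
  field_simp

theorem norm_pow (p : ℕ) : HomogCont (2 * p) fun x : EuclideanSpace ℂ ι => ((‖x‖ ^ (2 * p) : ℝ) : ℂ)
    where
  continuous := by fun_prop
  map_smul r hr x := by
    rw [norm_smul, Real.norm_of_nonneg hr, mul_pow]
    push_cast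
    rfl

/-- Comparing `F` with `‖x‖ ^ (2 * p)`, which has the same degree and equals `1` on the sphere,
eliminates the common radial factor. -/
theorem integral_haarState [Nonempty ι] (hF : HomogCont (2 * p) F) :
    (∫ ψ : PureState ι, F ψ ∂(haarState ι)) * gaussianMoment ι p = ∫ x, F x ∂(gaussian ι) := by
  have h0 : (volume : Measure (EuclideanSpace ℂ ι)).toSphere Set.univ ≠ 0 := by
    rw [Ne, Measure.measure_univ_eq_zero]
    exact Measure.toSphere_ne_zero _
  have h1 := (norm_pow (ι := ι) p).integral_eq
  rw [integral_complex_ofReal] at h1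
  rw [gaussianMoment, h1, hF.integral_eq, haarState, integral_smul_measure]
  have h2 : ∀ θ : PureState ι, ‖θ.1‖ = 1 := fun θ => by simp
  simp only [h2, one_pow, Complex.ofReal_one, integral_const, ENNReal.toReal_inv,
    Complex.real_smul]
  have h3 : ((volume : Measure (EuclideanSpace ℂ ι)).toSphere Set.univ).toReal ≠ 0 :=
    ENNReal.toReal_ne_zero.mpr ⟨h0, measure_ne_top _ _⟩
  have h4 : (((volume : Measure (EuclideanSpace ℂ ι)).toSphere Set.univ).toReal : ℂ) ≠ 0 := by
    exact_mod_cast h3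
  rw [measureReal_def]
  push_cast
  field_simp

omit [Fintype ι] in
theorem const (c : ℂ) : HomogCont 0 fun _ : EuclideanSpace ℂ ι => c :=
  ⟨continuous_const, by simp⟩

omit [Fintype ι] in
theorem coord (i : ι) : HomogCont 1 fun x : EuclideanSpace ℂ ι => x i :=
  ⟨by fun_prop, fun r _ x => by simp⟩

omit [Fintype ι] in
theorem coord_star (i : ι) : HomogCont 1 fun x : EuclideanSpace ℂ ι => star (x i) :=
  ⟨by fun_prop, fun r _ x => by simp⟩

omit [Fintype ι] in
theorem mul {a b : ℕ} (hF : HomogCont a F) (hG : HomogCont b G) :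
    HomogCont (a + b) fun x => F x * G x :=
  ⟨hF.continuous.mul hG.continuous, fun r hr x => by
    rw [hF.map_smul r hr, hG.map_smul r hr, pow_add]; ring⟩

omit [Fintype ι] in
theorem const_mul (c : ℂ) (hF : HomogCont n F) : HomogCont n fun x => c * F x :=
  ⟨hF.continuous.const_mul c, fun r hr x => by rw [hF.map_smul r hr]; ring⟩

omit [Fintype ι] in
theorem sum {ν : Type*} {s : Finset ν} {F : ν → EuclideanSpace ℂ ι → ℂ}
    (hF : ∀ i ∈ s, HomogCont n (F i)) : HomogCont n fun x => ∑ i ∈ s, F i x :=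
  ⟨continuous_finsetSum _ fun i hi => (hF i hi).continuous, fun r hr x => by
    rw [Finset.mul_sum]; exact Finset.sum_congr rfl fun i hi => (hF i hi).map_smul r hr x⟩

omit [Fintype ι] in
theorem prod {t a : ℕ} {F : Fin t → EuclideanSpace ℂ ι → ℂ}
    (hF : ∀ i, HomogCont a (F i)) : HomogCont (t * a) fun x => ∏ i, F i x :=
  ⟨continuous_finsetProd _ fun i _ => (hF i).continuous, fun r hr x => by
    simp only [(hF _).map_smul r hr, Finset.prod_mul_distrib, Finset.prod_const,
      Finset.card_univ, Fintype.card_fin]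
    rw [← pow_mul, mul_comm a]⟩

end HomogCont

end Gaussian

/-! ### A Gaussian vector on a qubit and a system as two independent Gaussian vectors -/

section Stacking

variable {ι κ : Type} [Fintype ι] [Fintype κ]

/-- The vector `|0⟩ ⊗ x + |1⟩ ⊗ y`, for a system `κ` identified with a qubit and a system `ι`. -/
noncomputable def stack (e : κ ≃ Fin 2 × ι) :
    (EuclideanSpace ℂ ι × EuclideanSpace ℂ ι) ≃ₗ[ℂ] EuclideanSpace ℂ κ where
  toFun z := WithLp.toLp 2 fun k => if (e k).1 = 0 then z.1 (e k).2 else z.2 (e k).2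
  invFun x := (WithLp.toLp 2 fun q => x (e.symm (0, q)), WithLp.toLp 2 fun q => x (e.symm (1, q)))
  map_add' z w := by
    ext k
    simp only [PiLp.add_apply, Prod.fst_add, Prod.snd_add]
    split_ifs <;> rfl
  map_smul' c z := by
    ext k
    simp only [PiLp.smul_apply, Prod.smul_fst, Prod.smul_snd, RingHom.id_apply]
    split_ifs <;> rfl
  left_inv z := by
    ext q <;> simp
  right_inv x := by
    ext k
    obtain ⟨⟨b, q⟩, rfl⟩ := e.symm.surjective k
    fin_cases b <;> simp

omit [Fintype ι] [Fintype κ] in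
theorem stack_apply (e : κ ≃ Fin 2 × ι) (z : EuclideanSpace ℂ ι × EuclideanSpace ℂ ι) (k : κ) :
    stack e z k = if (e k).1 = 0 then z.1 (e k).2 else z.2 (e k).2 := rfl

theorem norm_stack_sq (e : κ ≃ Fin 2 × ι) (z : EuclideanSpace ℂ ι × EuclideanSpace ℂ ι) :
    ‖stack e z‖ ^ 2 = ‖z.1‖ ^ 2 + ‖z.2‖ ^ 2 := by
  simp only [EuclideanSpace.norm_sq_eq, stack_apply]
  rw [← e.symm.sum_comp, Fintype.sum_prod_type, Fin.sum_univ_two]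
  simp

/-- `stack` as a continuous linear equivalence of real vector spaces. -/
noncomputable def stackL (e : κ ≃ Fin 2 × ι) :
    (EuclideanSpace ℂ ι × EuclideanSpace ℂ ι) ≃L[ℝ] EuclideanSpace ℂ κ :=
  ((stack e).restrictScalars ℝ).toContinuousLinearEquiv

theorem continuous_stack (e : κ ≃ Fin 2 × ι) : Continuous (stack e) := (stackL e).continuous

/-- Lebesgue measure corresponds to a product by uniqueness of Haar measure, and the density factors
because squared norms add. The value of `c` is irrelevant: it cancels against the same constant in
`gaussianMoment_stack`. -/
theorem exists_gaussian_eq_smul_map_stack [Nonempty ι] (e : κ ≃ Fin 2 × ι) :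
    ∃ c : NNReal, gaussian κ =
      c • Measure.map (stack e) ((gaussian ι).prod (gaussian ι)) := by
  have hprod : ((volume : Measure (EuclideanSpace ℂ ι)).prod
      (volume : Measure (EuclideanSpace ℂ ι))).IsAddHaarMeasure :=
    Measure.prod.instIsAddHaarMeasure _ _
  have := (stackL e).isAddHaarMeasure_map ((volume : Measure (EuclideanSpace ℂ ι)).prod volume)
  have h := Measure.isAddLeftInvariant_eq_smul (volume : Measure (EuclideanSpace ℂ κ))
    (((volume : Measure (EuclideanSpace ℂ ι)).prod volume).map (stackL e))
  obtain ⟨c, hc⟩ : ∃ c : NNReal, (volume : Measure (EuclideanSpace ℂ κ)) =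
      c • ((volume : Measure (EuclideanSpace ℂ ι)).prod volume).map (stack e) := ⟨_, h⟩
  refine ⟨c, ?_⟩
  · have hm : Measurable (stack e) := (continuous_stack e).measurable
    rw [gaussian, hc, gaussian, prod_withDensity measurable_exp_neg_norm_sq
      measurable_exp_neg_norm_sq]
    change (((c : ENNReal) • _ : Measure _).withDensity _) = (c : ENNReal) • _
    rw [withDensity_smul_measure]
    congr 1
    ext s hs
    rw [withDensity_apply _ hs, setLIntegral_map hs measurable_exp_neg_norm_sq hm,
      Measure.map_apply hm hs, withDensity_apply _ (hm hs)]
    refine lintegral_congr fun z => ?_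
    rw [norm_stack_sq, neg_add, Real.exp_add, ENNReal.ofReal_mul (Real.exp_nonneg _)]

/-- The constant relating the Gaussian measure to the product of two Gaussian measures. -/
noncomputable def stackConst [Nonempty ι] (e : κ ≃ Fin 2 × ι) : NNReal :=
  (exists_gaussian_eq_smul_map_stack e).choose

theorem gaussian_eq_smul_map_stack [Nonempty ι] (e : κ ≃ Fin 2 × ι) : gaussian κ =
    stackConst e • Measure.map (stack e) ((gaussian ι).prod (gaussian ι)) :=
  (exists_gaussian_eq_smul_map_stack e).choose_spec

theorem integral_gaussian_stack [Nonempty ι] {F : Type*} [NormedAddCommGroup F] [NormedSpace ℝ F]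
    (e : κ ≃ Fin 2 × ι) (f : EuclideanSpace ℂ κ → F) :
    ∫ x, f x ∂(gaussian κ) =
      (stackConst e : ℝ) • ∫ z, f (stack e z) ∂((gaussian ι).prod (gaussian ι)) := by
  rw [gaussian_eq_smul_map_stack e, integral_smul_nnreal_measure]
  congr 1
  exact ((continuous_stack e).measurableEmbedding (stack e).injective).integral_map f

end Stacking

/-! ### Unitary invariance of the Gaussian measure -/

section UnitaryInvariance

variable {κ σ : Type} [Fintype κ] [DecidableEq κ]

/-- A unitary matrix as a linear isometry of the Euclidean space. -/
noncomputable def unitaryIsometry (W : unitaryGroup κ ℂ) :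
    EuclideanSpace ℂ κ ≃ₗᵢ[ℂ] EuclideanSpace ℂ κ :=
  Unitary.linearIsometryEquiv
    ⟨toEuclideanCLM (n := κ) (𝕜 := ℂ) W.1, by
      rw [Unitary.mem_iff, ← map_star, ← map_mul, ← map_mul, Unitary.star_mul_self_of_mem W.2,
        Unitary.mul_star_self_of_mem W.2, map_one]
      exact ⟨rfl, rfl⟩⟩

theorem unitaryIsometry_apply (W : unitaryGroup κ ℂ) (x : EuclideanSpace ℂ κ) (i : κ) :
    unitaryIsometry W x i = (W.1 *ᵥ x.ofLp) i := rfl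

theorem measurePreserving_unitaryIsometry (W : unitaryGroup κ ℂ) :
    MeasurePreserving (unitaryIsometry W) (volume : Measure (EuclideanSpace ℂ κ)) volume := by
  let L : EuclideanSpace ℂ κ ≃ₗᵢ[ℝ] EuclideanSpace ℂ κ :=
    { (unitaryIsometry W).toLinearEquiv.restrictScalars ℝ with
      norm_map' := (unitaryIsometry W).norm_map }
  exact L.measurePreserving

theorem integral_gaussian_unitary (W : unitaryGroup κ ℂ) (f : EuclideanSpace ℂ κ → ℂ) :
    ∫ x, f (unitaryIsometry W x) ∂(gaussian κ) = ∫ x, f x ∂(gaussian κ) := by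
  rw [integral_gaussian_eq, integral_gaussian_eq]
  rw [← (measurePreserving_unitaryIsometry W).integral_comp
      (unitaryIsometry W).toHomeomorph.measurableEmbedding fun x => Real.exp (-‖x‖ ^ 2) • f x]
  simp only [LinearIsometryEquiv.norm_map]

end UnitaryInvariance

/-! ### Tensor powers of vectors and matrices -/

section TensorPower

variable {ι κ : Type}

/-- The `t`-fold tensor power of a vector. -/
def tpow (t : ℕ) (x : ι → ℂ) : (Fin t → ι) → ℂ := fun s => ∏ i, x (s i)

theorem tensorPow_vecMulVec (t : ℕ) (x y : ι → ℂ) :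
    tensorPow (vecMulVec x y) t = vecMulVec (tpow t x) (tpow t y) := by
  ext s s'
  simp [tensorPow, vecMulVec_apply, tpow, Finset.prod_mul_distrib]

theorem tpow_star (t : ℕ) (x : ι → ℂ) : tpow t (star x) = star (tpow t x) := by
  ext s
  simp [tpow]

theorem tensorPow_one [DecidableEq ι] (t : ℕ) : tensorPow (1 : Matrix ι ι ℂ) t = 1 := by
  ext s s'
  simp only [tensorPow, Matrix.of_apply, Matrix.one_apply, funext_iff]
  rw [Finset.prod_ite_zero]
  simp

theorem tensorPow_mul [Fintype ι] (A B : Matrix ι ι ℂ) (t : ℕ) :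
    tensorPow (A * B) t = tensorPow A t * tensorPow B t := by
  ext s s'
  simp only [tensorPow, Matrix.of_apply, Matrix.mul_apply, ← Finset.prod_mul_distrib]
  rw [Finset.prod_univ_sum, Fintype.piFinset_univ]

theorem tensorPow_conjTranspose (A : Matrix ι ι ℂ) (t : ℕ) :
    tensorPow Aᴴ t = (tensorPow A t)ᴴ := by
  ext s s'
  simp [tensorPow, conjTranspose_apply]

theorem sum_norm_sq_tpow [Fintype ι] (t : ℕ) (x : EuclideanSpace ℂ ι) :
    ∑ s, star (tpow t x.ofLp s) * tpow t x.ofLp s = ((‖x‖ ^ (2 * t) : ℝ) : ℂ) := by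
  have h : ∀ s : Fin t → ι, star (tpow t x.ofLp s) * tpow t x.ofLp s =
      ∏ i, (star (x (s i)) * x (s i)) := fun s => by
    simp [tpow, Finset.prod_mul_distrib]
  simp only [h]
  rw [← Fintype.piFinset_univ, ← Finset.prod_univ_sum (fun _ => Finset.univ)
    (fun (_ : Fin t) q => star (x q) * x q), Finset.prod_const, Finset.card_univ, Fintype.card_fin,
    pow_mul, EuclideanSpace.norm_sq_eq]
  push_cast
  congr 1
  refine Finset.sum_congr rfl fun q _ => ?_
  exact RCLike.conj_mul _

end TensorPower

/-! ### Expansion of the tensor power of a stacked vector -/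

section Interleave

variable {ι κ : Type} [Fintype ι] [DecidableEq ι] [Fintype κ]

/-- The registers of a basis state whose qubit is `|0⟩`. -/
def zeros (e : κ ≃ Fin 2 × ι) {t : ℕ} (x : Fin t → κ) : Finset (Fin t) :=
  Finset.univ.filter fun i => (e (x i)).1 = 0

/-- The operator interleaving `j` registers of system `ι`, labelled by the qubit state `|0⟩`, with
copies of the vector `y`, labelled by the qubit state `|1⟩`, in all possible orders. -/
def interleave (e : κ ≃ Fin 2 × ι) (t j : ℕ) (y : ι → ℂ) : Matrix (Fin t → κ) (Fin j → ι) ℂ :=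
  Matrix.of fun x s => if h : (zeros e x).card = j then
    if s = fun a => (e (x ((zeros e x).orderEmbOfFin h a))).2 then
      ∏ i ∈ (zeros e x)ᶜ, y (e (x i)).2 else 0
  else 0

omit [Fintype κ] in
-- In a given coordinate only one term survives, the one where `j` is the number of registers with
-- qubit `|0⟩`; the product over registers then splits into a `z.1` part and a `z.2` part.
theorem tpow_stack (e : κ ≃ Fin 2 × ι) (t : ℕ) (z : EuclideanSpace ℂ ι × EuclideanSpace ℂ ι) :
    tpow t (stack e z).ofLp =
      ∑ j ∈ Finset.range (t + 1), interleave e t j z.2.ofLp *ᵥ tpow j z.1.ofLp := by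
  ext x
  have hcard : (zeros e x).card ∈ Finset.range (t + 1) := by
    rw [Finset.mem_range, Nat.lt_succ_iff]
    simpa using Finset.card_le_univ (zeros e x)
  rw [Finset.sum_apply, Finset.sum_eq_single_of_mem _ hcard]
  · simp only [mulVec, dotProduct, interleave, Matrix.of_apply, dite_true, ite_mul, zero_mul,
      Finset.sum_ite_eq', Finset.mem_univ, if_true]
    rw [tpow, tpow, ← Finset.prod_compl_mul_prod (zeros e x)]
    congr 1
    · refine Finset.prod_congr rfl fun i hi => ?_
      have : ¬ (e (x i)).1 = 0 := by simpa [zeros] using hi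
      rw [stack_apply, if_neg this]
    · conv_lhs => rw [← Finset.map_orderEmbOfFin_univ (zeros e x) rfl, Finset.prod_map]
      refine Finset.prod_congr rfl fun a _ => ?_
      have h : (zeros e x).orderEmbOfFin rfl a ∈ zeros e x := Finset.orderEmbOfFin_mem _ _ _
      have : (e (x ((zeros e x).orderEmbOfFin rfl a))).1 = 0 := by
        simpa [zeros] using h
      rw [stack_apply]
      exact if_pos this
  · intro j _ hj
    simp only [mulVec, dotProduct, interleave, Matrix.of_apply]
    simp [Ne.symm hj]

theorem sum_prod_interleave (e : κ ≃ Fin 2 × ι) {t j : ℕ} (y : EuclideanSpace ℂ ι) (s : Fin j → ι)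
    (S : Finset (Fin t)) (hS : S.card = j) :
    ∑ x ∈ Finset.univ.filter (fun x : Fin t → κ => zeros e x = S),
      star (interleave e t j y.ofLp x s) * interleave e t j y.ofLp x s =
      ((‖y‖ ^ (2 * (t - j)) : ℝ) : ℂ) := by
  -- For a fixed set `S` of zero positions the summand is a product of one weight per register:
  -- registers in `S` must match `s`, the others contribute a squared coordinate of `y`. The sum
  -- over `x` thus becomes a product of sums.
  let φ : Fin t → κ → ℂ := fun i k =>
    if hi : i ∈ S then if e k = (0, s ((S.orderIsoOfFin hS).symm ⟨i, hi⟩)) then 1 else 0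
    else if (e k).1 = 0 then 0 else star (y (e k).2) * y (e k).2
  have h1 : ∀ x : Fin t → κ, (if zeros e x = S then
      star (interleave e t j y.ofLp x s) * interleave e t j y.ofLp x s else 0) =
      ∏ i, φ i (x i) := by
    intro x
    by_cases hx : zeros e x = S
    · rw [if_pos hx]
      subst hx
      have hmem : ∀ i, i ∈ zeros e x ↔ (e (x i)).1 = 0 := fun i => by simp [zeros]
      simp only [interleave, Matrix.of_apply, dif_pos hS]
      split_ifs with hs
      · rw [← Finset.prod_compl_mul_prod (zeros e x)]
        have h2 : ∏ i ∈ zeros e x, φ i (x i) = 1 := by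
          refine Finset.prod_eq_one fun i hi => ?_
          simp only [φ, dif_pos hi]
          rw [if_pos]
          refine Prod.ext ((hmem i).mp hi) ?_
          rw [hs]
          simp [← Finset.coe_orderIsoOfFin_apply]
        rw [h2, mul_one, star_prod, ← Finset.prod_mul_distrib]
        refine Finset.prod_congr rfl fun i hi => ?_
        rw [Finset.mem_compl] at hi
        simp only [φ, dif_neg hi]
        rw [if_neg (fun h => hi ((hmem i).mpr h))]
      · rw [star_zero, zero_mul, eq_comm]
        obtain ⟨a, ha⟩ := Function.ne_iff.mp hs
        have hi : (zeros e x).orderEmbOfFin hS a ∈ zeros e x := Finset.orderEmbOfFin_mem _ _ _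
        refine Finset.prod_eq_zero (Finset.mem_univ ((zeros e x).orderEmbOfFin hS a)) ?_
        simp only [φ, dif_pos hi]
        rw [if_neg]
        intro h
        apply ha
        rw [h]
        congr 1
        rw [eq_comm, OrderIso.symm_apply_eq]
        exact Subtype.ext (Finset.coe_orderIsoOfFin_apply _ _ _).symm
    · rw [if_neg hx, eq_comm]
      obtain ⟨i, hi⟩ : ∃ i, ¬ (i ∈ zeros e x ↔ i ∈ S) := by
        by_contra h
        push Not at h
        exact hx (Finset.ext h)
      refine Finset.prod_eq_zero (Finset.mem_univ i) ?_
      have hmem : i ∈ zeros e x ↔ (e (x i)).1 = 0 := by simp [zeros]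
      rw [hmem] at hi
      by_cases hiS : i ∈ S
      · have h0 : ¬ (e (x i)).1 = 0 := fun h => hi ⟨fun _ => hiS, fun _ => h⟩
        simp only [φ, dif_pos hiS]
        rw [if_neg]
        intro h
        exact h0 (by rw [h])
      · have h0 : (e (x i)).1 = 0 := by
          by_contra h
          exact hi ⟨fun h' => absurd h' h, fun h' => absurd h' hiS⟩
        simp only [φ, dif_neg hiS, if_pos h0]
  rw [Finset.sum_filter]
  simp only [h1]
  rw [← Fintype.piFinset_univ, ← Finset.prod_univ_sum (fun _ => Finset.univ) φ,
    ← Finset.prod_compl_mul_prod S]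
  have h2 : ∏ i ∈ S, ∑ k, φ i k = 1 := by
    refine Finset.prod_eq_one fun i hi => ?_
    simp only [φ, dif_pos hi]
    rw [← e.symm.sum_comp]
    simp
  have h3 : ∀ i ∈ Sᶜ, ∑ k, φ i k = ((‖y‖ ^ 2 : ℝ) : ℂ) := fun i hi => by
    rw [Finset.mem_compl] at hi
    simp only [φ, dif_neg hi]
    rw [← e.symm.sum_comp, Fintype.sum_prod_type, Fin.sum_univ_two, EuclideanSpace.norm_sq_eq]
    simp [Complex.conj_mul']
  rw [h2, mul_one, Finset.prod_congr rfl h3, Finset.prod_const, Finset.card_compl, hS,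
    Fintype.card_fin, ← Complex.ofReal_pow, ← pow_mul]

/-- A row index `x` determines the one column that can be nonzero, so the columns are orthogonal;
`t.choose j` counts the possible zero sets, each contributing `‖y‖ ^ (2 * (t - j))`. Conjugation by
`interleave` therefore costs exactly this scalar in `traceNorm_conj_le`. -/
theorem interleave_conjTranspose_mul_self (e : κ ≃ Fin 2 × ι) (t j : ℕ)
    (y : EuclideanSpace ℂ ι) :
    (interleave e t j y.ofLp)ᴴ * interleave e t j y.ofLp =
      ((t.choose j * ‖y‖ ^ (2 * (t - j)) : ℝ) : ℂ) • (1 : Matrix (Fin j → ι) (Fin j → ι) ℂ) := by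
  ext s s'
  rw [Matrix.mul_apply, Matrix.smul_apply, Matrix.one_apply]
  simp only [conjTranspose_apply]
  by_cases hs : s = s'
  · subst hs
    rw [if_pos rfl]
    have h0 : ∀ x : Fin t → κ, (zeros e x).card ≠ j → interleave e t j y.ofLp x s = 0 :=
      fun x hx => by simp [interleave, hx]
    have h1 : ∑ x, star (interleave e t j y.ofLp x s) * interleave e t j y.ofLp x s =
        ∑ S ∈ Finset.powersetCard j (Finset.univ : Finset (Fin t)),
          ∑ x ∈ Finset.univ.filter (fun x : Fin t → κ => zeros e x = S),
            star (interleave e t j y.ofLp x s) * interleave e t j y.ofLp x s := by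
      rw [← Finset.sum_fiberwise (Finset.univ) (zeros e)]
      refine (Finset.sum_subset (Finset.subset_univ _) fun S _ hS => ?_).symm
      refine Finset.sum_eq_zero fun x hx => ?_
      have hx' : zeros e x = S := by simpa using hx
      rw [h0 x, mul_zero]
      rintro h
      exact hS (by simp [Finset.mem_powersetCard, ← hx', h])
    rw [h1, Finset.sum_congr rfl fun S hS =>
      sum_prod_interleave e y s S (Finset.mem_powersetCard.mp hS).2]
    simp
  · rw [if_neg hs, smul_zero]
    refine Finset.sum_eq_zero fun x _ => ?_
    simp only [interleave, Matrix.of_apply]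
    split_ifs with h h1 h2
    · exact absurd (h1.trans h2.symm) hs
    all_goals simp

end Interleave

/-! ### Homogeneous matrix-valued functions -/

section HomogMat

variable {ι κ σ τ σ' τ' : Type}

/-- Matrix-valued functions whose entries are continuous and homogeneous of degree `n`. -/
def HomogMat (n : ℕ) (M : EuclideanSpace ℂ ι → Matrix σ τ ℂ) : Prop :=
  ∀ x y, HomogCont n fun g => M g x y

namespace HomogMat

variable {n a b p : ℕ} {M : EuclideanSpace ℂ ι → Matrix σ τ ℂ}

theorem const (A : Matrix σ τ ℂ) : HomogMat 0 fun _ : EuclideanSpace ℂ ι => A :=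
  fun x y => .const (A x y)

theorem smul (c : ℂ) (hM : HomogMat n M) : HomogMat n fun g => c • M g :=
  fun x y => (hM x y).const_mul c

theorem sum {ν : Type*} {s : Finset ν} {M : ν → EuclideanSpace ℂ ι → Matrix σ τ ℂ}
    (hM : ∀ i ∈ s, HomogMat n (M i)) : HomogMat n fun g => ∑ i ∈ s, M i g := by
  intro x y
  simp only [Matrix.sum_apply]
  exact .sum fun i hi => hM i hi x y

theorem mul_mul [Fintype σ] [Fintype τ] (hM : HomogMat n M) (L : Matrix σ' σ ℂ)
    (R : Matrix τ τ' ℂ) : HomogMat n fun g => L * M g * R := by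
  intro x y
  simp only [Matrix.mul_apply, Finset.sum_mul]
  refine .sum fun j _ => .sum fun i _ => ?_
  have h := (hM i j).const_mul (L x i * R j y)
  convert h using 2
  ring

theorem kronecker {N : EuclideanSpace ℂ ι → Matrix σ' τ' ℂ} (hM : HomogMat a M)
    (hN : HomogMat b N) : HomogMat (a + b) fun g => M g ⊗ₖ N g :=
  fun x y => (hM x.1 y.1).mul (hN x.2 y.2)

theorem proj : HomogMat 2 fun g : EuclideanSpace ℂ ι => vecMulVec g.ofLp (star g.ofLp) :=
  fun x y => (HomogCont.coord x).mul (HomogCont.coord_star y)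

theorem vecMulVec_tpow (j j' : ℕ) : HomogMat (j + j') fun g : EuclideanSpace ℂ ι =>
    vecMulVec (tpow j g.ofLp) (star (tpow j' g.ofLp)) := by
  intro x y
  have h := (HomogCont.prod (t := j) (a := 1) fun i => HomogCont.coord (x i)).mul
    (HomogCont.prod (t := j') (a := 1) fun i => HomogCont.coord_star (y i))
  simp only [mul_one] at h
  convert h using 2
  simp [vecMulVec_apply, tpow]

theorem tensorPow_proj (t : ℕ) : HomogMat (2 * t) fun g : EuclideanSpace ℂ ι =>
    tensorPow (vecMulVec g.ofLp (star g.ofLp)) t := by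
  have h := vecMulVec_tpow (ι := ι) t t
  simp only [← tpow_star, ← tensorPow_vecMulVec, ← two_mul] at h
  exact h

variable [Fintype ι]

theorem matIntegrable [Nonempty ι] (hM : HomogMat n M) : MatIntegrable (gaussian ι) M :=
  fun x y => (hM x y).integrable

theorem matIntegrable_haarState [Nonempty ι] (hM : HomogMat n M) :
    MatIntegrable (haarState ι) fun ψ : PureState ι => M ψ.1 := fun x y =>
  ((hM x y).continuous.comp continuous_subtype_val).integrable_of_hasCompactSupport
    (HasCompactSupport.of_compactSpace _)

theorem matInt_gaussian [Nonempty ι] (hM : HomogMat (2 * p) M) :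
    matInt (gaussian ι) M =
      (gaussianMoment ι p : ℂ) • matInt (haarState ι) fun ψ : PureState ι => M ψ.1 := by
  ext x y
  rw [Matrix.smul_apply, smul_eq_mul, mul_comm]
  exact ((hM x y).integral_haarState).symm

end HomogMat

end HomogMat

/-! ### The difference operator and its monotonicity in the number of copies -/

section Defect

variable {ι κ : Type} [Fintype ι] [DecidableEq ι] [Fintype κ] [DecidableEq κ] {n : ℕ}

omit [Fintype κ] [DecidableEq κ] in
theorem keyExp_kronecker {σ : Type} (M : (Fin n → Bool) → Matrix κ κ ℂ) (B : Matrix σ σ ℂ) :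
    keyExp (fun k => M k ⊗ₖ B) = keyExp M ⊗ₖ B := by
  ext x y
  simp [keyExp, Matrix.sum_apply, Finset.sum_mul, mul_assoc]

theorem keyExp_mul_mul {σ τ : Type} [Fintype σ] (M : (Fin n → Bool) → Matrix σ σ ℂ)
    (L : Matrix τ σ ℂ) (R : Matrix σ τ ℂ) :
    keyExp (fun k => L * M k * R) = L * keyExp M * R := by
  simp only [keyExp, Matrix.mul_smul, Matrix.smul_mul, Matrix.mul_sum, Matrix.sum_mul]

/-- The channel applying a uniformly random member of the family `V`. -/
noncomputable def keyChannel (V : (Fin n → Bool) → Matrix κ κ ℂ) (A : Matrix κ κ ℂ) : Matrix κ κ ℂ :=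
  keyExp fun k => V k * A * (V k)ᴴ

/-- The unnormalised state `E_k (V_k x V_kᴴ) ⊗ x^{⊗ t}` of a vector `x`. -/
noncomputable def keyState (V : (Fin n → Bool) → Matrix κ κ ℂ) (t : ℕ) (x : EuclideanSpace ℂ κ) :
    Matrix (κ × (Fin t → κ)) (κ × (Fin t → κ)) ℂ :=
  keyChannel V (vecMulVec x.ofLp (star x.ofLp)) ⊗ₖ tensorPow (vecMulVec x.ofLp (star x.ofLp)) t

/-- The unnormalised state `I / d ⊗ x^{⊗ t}` of a vector `x`. -/
noncomputable def mixedState (t : ℕ) (x : EuclideanSpace ℂ κ) :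
    Matrix (κ × (Fin t → κ)) (κ × (Fin t → κ)) ℂ :=
  ((Fintype.card κ : ℂ)⁻¹ • (1 : Matrix κ κ ℂ)) ⊗ₖ tensorPow (vecMulVec x.ofLp (star x.ofLp)) t

/-- The difference between the Haar averages of `keyState` and `mixedState`. -/
noncomputable def defect (V : (Fin n → Bool) → Matrix κ κ ℂ) (t : ℕ) :
    Matrix (κ × (Fin t → κ)) (κ × (Fin t → κ)) ℂ :=
  matInt (haarState κ) (fun ψ : PureState κ => keyState V t ψ.1) -
    matInt (haarState κ) (fun ψ : PureState κ => mixedState t ψ.1)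

omit [Fintype ι] [DecidableEq ι] [DecidableEq κ] in
theorem homogMat_keyChannel (V : (Fin n → Bool) → Matrix κ κ ℂ) :
    HomogMat 2 fun x : EuclideanSpace ℂ κ => keyChannel V (vecMulVec x.ofLp (star x.ofLp)) :=
  HomogMat.smul _ (HomogMat.sum fun _ _ => HomogMat.proj.mul_mul _ _)

omit [DecidableEq κ] in
theorem homogMat_keyState (V : (Fin n → Bool) → Matrix κ κ ℂ) (t : ℕ) :
    HomogMat (2 * (t + 1)) (keyState V t) := by
  have h := (homogMat_keyChannel V).kronecker (HomogMat.tensorPow_proj (ι := κ) t)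
  rwa [show 2 + 2 * t = 2 * (t + 1) by ring] at h

theorem homogMat_mixedState (t : ℕ) : HomogMat (2 * t) (mixedState (κ := κ) t) := by
  have h := (HomogMat.const (ι := κ) ((Fintype.card κ : ℂ)⁻¹ • (1 : Matrix κ κ ℂ))).kronecker
    (HomogMat.tensorPow_proj (ι := κ) t)
  rwa [zero_add] at h

theorem distFromMixed_eq_traceNorm_defect {m : ℕ}
    (V : (Fin n → Bool) → Matrix (Qubits m) (Qubits m) ℂ)
    (t : ℕ) : distFromMixed V t = traceNorm (defect V t) := by
  have h1 : ∀ k, MatIntegrable (haarState (Qubits m)) fun ψ : PureState (Qubits m) =>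
      (V k * density ψ * (V k)ᴴ) ⊗ₖ tensorPow (density ψ) t := fun k =>
    ((HomogMat.proj.mul_mul (V k) (V k)ᴴ).kronecker
      (HomogMat.tensorPow_proj t)).matIntegrable_haarState
  have h2 : keyExp (fun k => haarExp fun ψ : PureState (Qubits m) =>
      (V k * density ψ * (V k)ᴴ) ⊗ₖ tensorPow (density ψ) t) =
      matInt (haarState (Qubits m)) fun ψ : PureState (Qubits m) => keyState V t ψ.1 := by
    simp only [keyState, keyChannel, ← keyExp_kronecker]
    simp only [keyExp]
    rw [matInt_smul]
    exact congrArg _ (matInt_sum fun k _ => h1 k).symm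
  have h3 : (haarExp fun ψ : PureState (Qubits m) => maxMixed m ⊗ₖ tensorPow (density ψ) t) =
      matInt (haarState (Qubits m)) fun ψ : PureState (Qubits m) => mixedState t ψ.1 := by
    have : maxMixed m = ((Fintype.card (Qubits m) : ℂ)⁻¹ • (1 : Matrix (Qubits m) (Qubits m) ℂ)) := by
      simp [maxMixed]
    rw [this]
    rfl
  rw [distFromMixed, h2, h3, defect]

theorem traceNorm_matInt_mixedState_le [Nonempty κ] (t : ℕ) :
    traceNorm (matInt (haarState κ) fun ψ : PureState κ => mixedState t ψ.1) ≤ 1 := by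
  have h : ∀ ψ : PureState κ, traceNorm (mixedState t ψ.1) ≤ 1 := by
    intro ψ
    -- The isometry `|k⟩ ↦ |k⟩ ⊗ ψ^{⊗ t}`, which carries the maximally mixed state to `mixedState`.
    let L : Matrix (κ × (Fin t → κ)) κ ℂ := Matrix.of fun p k =>
      if p.1 = k then tpow t ψ.1.ofLp p.2 else 0
    have hL : Lᴴ * L = ((1 : ℝ) : ℂ) • (1 : Matrix κ κ ℂ) := by
      ext k k'
      rw [Matrix.mul_apply, Fintype.sum_prod_type]
      simp only [conjTranspose_apply, L, Matrix.of_apply, Complex.ofReal_one, one_smul,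
        Matrix.one_apply]
      have := sum_norm_sq_tpow t ψ.1
      rw [show ‖ψ.1‖ = 1 by simp, one_pow] at this
      split_ifs with hk
      · subst hk
        rw [Finset.sum_eq_single_of_mem k (Finset.mem_univ _)
          (fun b _ hb => by simp [hb])]
        simpa using this
      · refine Finset.sum_eq_zero fun a _ => Finset.sum_eq_zero fun s _ => ?_
        by_cases ha : a = k
        · subst ha; simp [hk]
        · simp [ha]
    have hM : mixedState t ψ.1 = L * ((Fintype.card κ : ℂ)⁻¹ • (1 : Matrix κ κ ℂ)) * Lᴴ := by
      rw [mixedState, tensorPow_vecMulVec, tpow_star]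
      ext p p'
      simp [Matrix.mul_apply, L, vecMulVec_apply, Matrix.one_apply]
      by_cases hp : p.1 = p'.1
      · simp only [hp, if_true]
        ring
      · simp [hp, Ne.symm hp]
    rw [hM]
    refine (traceNorm_conj_le zero_le_one hL _).trans ?_
    rw [one_mul]
    refine (traceNorm_smul_le _ _).trans ?_
    have hc : (0 : ℝ) < Fintype.card κ := by exact_mod_cast Fintype.card_pos
    rw [norm_inv, Complex.norm_natCast, inv_mul_le_iff₀ hc, mul_one]
    exact traceNorm_one_le
  refine (traceNorm_matInt_le (homogMat_mixedState t).matIntegrable_haarState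
    (integrable_const 1) h).trans ?_
  simp

/-- Tracing out one spare copy of a unit vector removes it. The equivalences move the head register
of `Fin (t + 1) → κ` to the end, where `traceNorm_partialTrace_le` applies. -/
theorem defect_eq_partialTrace (V : (Fin n → Bool) → Matrix κ κ ℂ) [Nonempty κ] (t : ℕ) :
    defect V t = Matrix.of fun x y => ∑ q, (defect V (t + 1)).submatrix
      ((Equiv.prodAssoc κ (Fin t → κ) κ).trans (Equiv.prodCongr (Equiv.refl κ)
        ((Equiv.prodComm _ _).trans (Fin.consEquiv fun _ => κ))))
      ((Equiv.prodAssoc κ (Fin t → κ) κ).trans (Equiv.prodCongr (Equiv.refl κ)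
        ((Equiv.prodComm _ _).trans (Fin.consEquiv fun _ => κ)))) (x, q) (y, q) := by
  have h : ∀ (ψ : PureState κ) (A : Matrix κ κ ℂ) (x y : κ × (Fin t → κ)),
      (A ⊗ₖ tensorPow (vecMulVec ψ.1.ofLp (star ψ.1.ofLp)) t) x y =
      ∑ q, (A ⊗ₖ tensorPow (vecMulVec ψ.1.ofLp (star ψ.1.ofLp)) (t + 1))
        (x.1, Fin.cons q x.2) (y.1, Fin.cons q y.2) := by
    intro ψ A x y
    have h1 : ∑ q, ψ.1 q * star (ψ.1 q) = 1 := by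
      have := EuclideanSpace.norm_sq_eq ψ.1
      rw [show ‖ψ.1‖ = 1 by simp, one_pow] at this
      have h2 : ((1 : ℝ) : ℂ) = _ := congrArg _ this
      rw [Complex.ofReal_one] at h2
      rw [h2]
      push_cast
      exact Finset.sum_congr rfl fun q _ => RCLike.mul_conj _
    simp only [kroneckerMap_apply, tensorPow, Matrix.of_apply, Fin.prod_univ_succ, Fin.cons_zero,
      Fin.cons_succ, vecMulVec_apply, Pi.star_apply]
    rw [← Finset.mul_sum, ← Finset.sum_mul, h1, one_mul]
  ext x y
  simp only [defect, Matrix.of_apply, submatrix_apply, Matrix.sub_apply, Finset.sum_sub_distrib,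
    matInt]
  rw [← integral_finsetSum _ fun q _ => (homogMat_keyState V (t + 1)).matIntegrable_haarState _ _,
    ← integral_finsetSum _ fun q _ => (homogMat_mixedState (t + 1)).matIntegrable_haarState _ _]
  congr 1
  · exact integral_congr_ae (Filter.Eventually.of_forall fun ψ => h ψ _ x y)
  · exact integral_congr_ae (Filter.Eventually.of_forall fun ψ => h ψ _ x y)

theorem traceNorm_defect_mono [Nonempty κ] (V : (Fin n → Bool) → Matrix κ κ ℂ) :
    Monotone fun t => traceNorm (defect V t) := by
  refine monotone_nat_of_le_succ fun t => ?_
  rw [defect_eq_partialTrace V t]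
  exact (traceNorm_partialTrace_le _).trans (traceNorm_submatrix_equiv_le _ _)

end Defect

/-! ### Operators acting on the distinguished qubit -/

section Blocks

variable {ι κ τ : Type} [Fintype ι] [DecidableEq ι] [Fintype κ] [DecidableEq κ]

/-- The operator `⟨b| ⊗ I` on a qubit and a system `ι`. -/
def qubitBra (e : κ ≃ Fin 2 × ι) (b : Fin 2) : Matrix ι κ ℂ :=
  Matrix.of fun q k => if k = e.symm (b, q) then 1 else 0

/-- The operator `w ⊗ U` on a qubit and a system `ι`. -/
def qubitTensor (e : κ ≃ Fin 2 × ι) (w : Matrix (Fin 2) (Fin 2) ℂ) (U : Matrix ι ι ℂ) :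
    Matrix κ κ ℂ :=
  (w ⊗ₖ U).submatrix e e

omit [Fintype ι] [DecidableEq ι] in
theorem qubitBra_mul_apply (e : κ ≃ Fin 2 × ι) (b : Fin 2) (A : Matrix κ τ ℂ) (q : ι) (x : τ) :
    (qubitBra e b * A) q x = A (e.symm (b, q)) x := by
  simp [qubitBra, Matrix.mul_apply]

omit [Fintype ι] in
theorem qubitBra_mul_conjTranspose (e : κ ≃ Fin 2 × ι) (b b' : Fin 2) :
    qubitBra e b * (qubitBra e b')ᴴ = if b = b' then 1 else 0 := by
  ext q q'
  rw [qubitBra_mul_apply, conjTranspose_apply]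
  split_ifs with h
  · simp [qubitBra, Matrix.one_apply, h, apply_ite, eq_comm]
  · simp [qubitBra, h]

omit [DecidableEq ι] in
theorem sum_conjTranspose_mul_qubitBra (e : κ ≃ Fin 2 × ι) :
    ∑ b, (qubitBra e b)ᴴ * qubitBra e b = 1 := by
  ext k k'
  simp only [Matrix.sum_apply, Matrix.mul_apply, conjTranspose_apply]
  rw [← Fintype.sum_prod_type', ← e.sum_comp fun x =>
    star (qubitBra e x.1 x.2 k) * qubitBra e x.1 x.2 k']
  simp [qubitBra, Matrix.one_apply, apply_ite, eq_comm]

theorem qubitBra_mul_qubitTensor (e : κ ≃ Fin 2 × ι) (b : Fin 2) (w : Matrix (Fin 2) (Fin 2) ℂ)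
    (U : Matrix ι ι ℂ) :
    qubitBra e b * qubitTensor e w U = ∑ b', w b b' • (U * qubitBra e b') := by
  ext q k
  obtain ⟨⟨c, r⟩, rfl⟩ := e.symm.surjective k
  rw [qubitBra_mul_apply]
  simp only [Matrix.sum_apply, Matrix.smul_apply, Matrix.mul_apply, qubitBra, Matrix.of_apply,
    EmbeddingLike.apply_eq_iff_eq, Prod.mk.injEq, qubitTensor, submatrix_apply,
    Equiv.apply_symm_apply, kroneckerMap_apply, smul_eq_mul]
  rw [Finset.sum_eq_single_of_mem c (Finset.mem_univ _)]
  · simp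
  · intro b' _ hb'
    simp [Ne.symm hb']

theorem qubitBra_mul_qubitTensor_one (e : κ ≃ Fin 2 × ι) (b : Fin 2) (U : Matrix ι ι ℂ) :
    qubitBra e b * qubitTensor e 1 U = U * qubitBra e b := by
  rw [qubitBra_mul_qubitTensor, Finset.sum_eq_single_of_mem b (Finset.mem_univ _)]
  · simp
  · intro b' _ hb'
    simp [Ne.symm hb']

omit [Fintype ι] [DecidableEq ι] in
theorem qubitBra_mulVec_stack (e : κ ≃ Fin 2 × ι) (z : EuclideanSpace ℂ ι × EuclideanSpace ℂ ι) :
    qubitBra e 0 *ᵥ (stack e z).ofLp = z.1.ofLp := by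
  ext q
  simp only [mulVec, dotProduct, qubitBra, Matrix.of_apply, ite_mul, one_mul, zero_mul,
    Finset.sum_ite_eq', Finset.mem_univ, if_true, stack_apply]
  simp

theorem mul_vecMulVec_mul_conjTranspose {σ τ ρ : Type} [Fintype σ] [Fintype τ] {σ' : Type}
    (L : Matrix ρ σ ℂ) (R : Matrix σ' τ ℂ) (x : σ → ℂ) (y : τ → ℂ) :
    L * vecMulVec x (star y) * Rᴴ = vecMulVec (L *ᵥ x) (star (R *ᵥ y)) := by
  rw [mul_vecMulVec, vecMulVec_mul, star_mulVec]

end Blocks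

/-! ### Gaussian averages with `j` kets and `j'` bras -/

section PairState

variable {ι κ : Type} [Fintype ι] [DecidableEq ι] [Fintype κ] [DecidableEq κ] {n : ℕ}

/-- The operator `(E_k U_k |g⟩⟨g| U_kᴴ - c) ⊗ |g⟩⟨g|^{⊗ (j, j')}`, with `j` kets and `j'` bras in
the second factor. -/
noncomputable def pairState (U : (Fin n → Bool) → Matrix ι ι ℂ) (c : ℂ) (j j' : ℕ)
    (g : EuclideanSpace ℂ ι) : Matrix (ι × (Fin j → ι)) (ι × (Fin j' → ι)) ℂ :=
  (keyChannel U (vecMulVec g.ofLp (star g.ofLp)) - c • 1) ⊗ₖ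
    vecMulVec (tpow j g.ofLp) (star (tpow j' g.ofLp))

theorem matIntegrable_pairState [Nonempty ι] (U : (Fin n → Bool) → Matrix ι ι ℂ) (c : ℂ)
    (j j' : ℕ) : MatIntegrable (gaussian ι) (pairState U c j j') := by
  intro x y
  have h1 := ((homogMat_keyChannel U).kronecker
    (HomogMat.vecMulVec_tpow (ι := ι) j j')).matIntegrable x y
  have h2 := ((HomogMat.const (ι := ι) (c • (1 : Matrix ι ι ℂ))).kronecker
    (HomogMat.vecMulVec_tpow (ι := ι) j j')).matIntegrable x y
  refine (h1.sub h2).congr (Filter.Eventually.of_forall fun g => ?_)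
  simp [pairState, sub_mul]

theorem tpow_smul {σ : Type} (t : ℕ) (c : ℂ) (x : σ → ℂ) : tpow t (c • x) = c ^ t • tpow t x := by
  ext s
  simp [tpow, Finset.prod_mul_distrib]

theorem exists_phase {j j' : ℕ} (h : j ≠ j') :
    ∃ w : ℂ, w * star w = 1 ∧ w ^ j * star (w ^ j') ≠ 1 := by
  have hN : j + j' + 1 ≠ 0 := by omega
  -- A root of unity of order `j + j' + 1` separates the exponents, since both are smaller than its
  -- order.
  have hw := Complex.isPrimitiveRoot_exp (j + j' + 1) hN
  set w := Complex.exp (2 * Real.pi * Complex.I / ((j + j' + 1 : ℕ) : ℂ))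
  have hnorm : ‖w‖ = 1 := hw.norm'_eq_one hN
  have hww : w * star w = 1 := by
    have := RCLike.mul_conj w
    rw [hnorm] at this
    simpa using this
  refine ⟨w, hww, fun h1 => h ?_⟩
  have h2 : w ^ j' * star (w ^ j') = 1 := by rw [star_pow, ← mul_pow, hww, one_pow]
  have h3 : star (w ^ j') ≠ 0 := right_ne_zero_of_mul_eq_one h2
  exact hw.pow_inj (by omega) (by omega) (mul_right_cancel₀ h3 (h1.trans h2.symm))

/-- Multiplying `g` by a phase `w` leaves the first factor unchanged and multiplies the second by `w
^ j * star (w ^ j')`, while the Gaussian integral is invariant. -/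
theorem matInt_pairState_of_ne (U : (Fin n → Bool) → Matrix ι ι ℂ) (c : ℂ)
    {j j' : ℕ} (h : j ≠ j') : matInt (gaussian ι) (pairState U c j j') = 0 := by
  obtain ⟨w, hw, hne⟩ := exists_phase h
  let W : unitaryGroup ι ℂ := ⟨w • 1, by
    rw [mem_unitaryGroup_iff, star_smul, star_one, Matrix.smul_mul, Matrix.one_mul, smul_smul,
      hw, one_smul]⟩
  have hW : ∀ g, (unitaryIsometry W g).ofLp = w • g.ofLp := fun g => by
    ext i
    rw [unitaryIsometry_apply]
    simp [W, smul_mulVec]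
  have hp : ∀ g, pairState U c j j' (unitaryIsometry W g) =
      (w ^ j * star (w ^ j')) • pairState U c j j' g := by
    intro g
    simp only [pairState, hW, tpow_smul, star_smul, vecMulVec_smul, smul_vecMulVec, smul_smul]
    rw [mul_comm (star w) w, hw, one_smul, kronecker_smul, mul_comm (star (w ^ j'))]
  ext x y
  have h1 := integral_gaussian_unitary W fun g => pairState U c j j' g x y
  simp only [hp, Matrix.smul_apply, smul_eq_mul] at h1
  rw [integral_const_mul] at h1
  have h2 : (w ^ j * star (w ^ j') - 1) * ∫ g, pairState U c j j' g x y ∂(gaussian ι) = 0 := by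
    rw [sub_mul, h1, one_mul, sub_self]
  exact (mul_eq_zero.mp h2).resolve_left (sub_ne_zero.mpr hne)

theorem matInt_pairState_self [Nonempty ι] (U : (Fin n → Bool) → Matrix ι ι ℂ) (c : ℂ) (j : ℕ) :
    matInt (gaussian ι) (pairState U c j j) =
      (gaussianMoment ι (j + 1) : ℂ) • defect U j +
      (gaussianMoment ι (j + 1) - c * Fintype.card ι * gaussianMoment ι j) •
        matInt (haarState ι) fun ψ : PureState ι => mixedState j ψ.1 := by
  have hc : (Fintype.card ι : ℂ) ≠ 0 := by exact_mod_cast Fintype.card_ne_zero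
  have h : pairState U c j j = fun g => keyState U j g - (c * Fintype.card ι) • mixedState j g := by
    funext g
    ext x y
    simp only [pairState, keyState, mixedState, tensorPow_vecMulVec, tpow_star, Matrix.sub_apply,
      Matrix.smul_apply, kroneckerMap_apply, smul_eq_mul]
    field_simp
  rw [h, matInt_sub (homogMat_keyState U j).matIntegrable
    ((homogMat_mixedState j).smul _).matIntegrable, matInt_smul,
    (homogMat_keyState U j).matInt_gaussian, (homogMat_mixedState j).matInt_gaussian, defect,
    smul_sub, smul_smul, sub_smul]
  abel

/-- The chosen `c` is centred between the values exact for `j = 0` and `j = t`, so the coefficient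
of the mixed part is `(j - t/2) * gaussianMoment ι j`. Monotonicity replaces `defect U j` by `defect
U t`. -/
theorem traceNorm_matInt_pairState_le [Nonempty ι] (U : (Fin n → Bool) → Matrix ι ι ℂ)
    {c : ℂ} {t j : ℕ} (hc : c * Fintype.card ι = Fintype.card ι + (t / 2 : ℝ)) (hj : j ≤ t) :
    traceNorm (matInt (gaussian ι) (pairState U c j j)) ≤
      gaussianMoment ι (j + 1) * traceNorm (defect U t) + gaussianMoment ι j * (t / 2) := by
  rw [matInt_pairState_self, hc]
  refine (traceNorm_add_le _ _).trans (add_le_add ?_ ?_)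
  · refine (traceNorm_smul_le _ _).trans ?_
    rw [Complex.norm_real, Real.norm_of_nonneg (gaussianMoment_pos _).le]
    exact mul_le_mul_of_nonneg_left (traceNorm_defect_mono U hj) (gaussianMoment_pos _).le
  · refine (traceNorm_smul_le _ _).trans ?_
    have h1 : (gaussianMoment ι (j + 1) - (Fintype.card ι + (t / 2 : ℝ)) * gaussianMoment ι j : ℂ)
        = (((j - t / 2) * gaussianMoment ι j : ℝ) : ℂ) := by
      rw [gaussianMoment_succ]
      push_cast
      ring
    rw [h1, Complex.norm_real, Real.norm_eq_abs, abs_mul, abs_of_pos (gaussianMoment_pos j)]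
    have h2 : |(j : ℝ) - t / 2| ≤ t / 2 := by
      have : (j : ℝ) ≤ t := by exact_mod_cast hj
      have : (0 : ℝ) ≤ j := j.cast_nonneg
      rw [abs_le]
      constructor <;> linarith
    calc _ ≤ t / 2 * gaussianMoment ι j * 1 := by
          refine mul_le_mul (mul_le_mul_of_nonneg_right h2 (gaussianMoment_pos _).le)
            (traceNorm_matInt_mixedState_le j) (traceNorm_nonneg _) ?_
          exact mul_nonneg (by positivity) (gaussianMoment_pos _).le
      _ = _ := by ring

end PairState

/-! ### The diagonal block of the large difference operator -/

section Block

variable {ι κ : Type} [Fintype ι] [Fintype κ] [Nonempty ι] [Nonempty κ]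

omit [Nonempty κ] in
theorem gaussianMoment_stack (e : κ ≃ Fin 2 × ι) (t : ℕ) :
    gaussianMoment κ t = stackConst e * ∑ j ∈ Finset.range (t + 1),
      t.choose j * gaussianMoment ι j * gaussianMoment ι (t - j) := by
  rw [gaussianMoment, integral_gaussian_stack e, smul_eq_mul]
  congr 1
  have h : ∀ z : EuclideanSpace ℂ ι × EuclideanSpace ℂ ι, ‖stack e z‖ ^ (2 * t) =
      ∑ j ∈ Finset.range (t + 1), (t.choose j * ‖z.1‖ ^ (2 * j)) * ‖z.2‖ ^ (2 * (t - j)) := by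
    intro z
    rw [pow_mul, norm_stack_sq, add_pow]
    refine Finset.sum_congr rfl fun j _ => ?_
    rw [← pow_mul, ← pow_mul]
    ring
  simp only [h]
  rw [integral_finsetSum _ fun j _ =>
    ((integrable_norm_pow_gaussian _).const_mul _).mul_prod (integrable_norm_pow_gaussian _)]
  refine Finset.sum_congr rfl fun j _ => ?_
  rw [integral_prod_mul (fun x : EuclideanSpace ℂ ι => (t.choose j * ‖x‖ ^ (2 * j) : ℝ))
    (fun y : EuclideanSpace ℂ ι => ‖y‖ ^ (2 * (t - j))), integral_const_mul]
  rfl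

theorem stackConst_ne_zero (e : κ ≃ Fin 2 × ι) : stackConst e ≠ 0 := by
  intro h
  have h1 := gaussianMoment_stack e 0
  rw [h, NNReal.coe_zero, zero_mul] at h1
  exact (gaussianMoment_pos (ι := κ) 0).ne' h1

/-- The weights are symmetric under `j ↔ t - j`, so `j` may be replaced by its mean `t / 2`. -/
theorem sum_choose_mul_succ_eq (D : ℝ) (t : ℕ) (f : ℕ → ℝ) :
    ∑ j ∈ Finset.range (t + 1), t.choose j * ((D + j) * f j) * f (t - j) =
      (D + t / 2) * ∑ j ∈ Finset.range (t + 1), t.choose j * f j * f (t - j) := by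
  have h := Finset.sum_flip (n := t) fun j : ℕ => (t.choose j * ((D + j) * f j) * f (t - j) : ℝ)
  have h2 : ∑ j ∈ Finset.range (t + 1), (t.choose j * ((D + j) * f j) * f (t - j) : ℝ) +
      ∑ j ∈ Finset.range (t + 1),
        (t.choose (t - j) * ((D + (t - j : ℕ)) * f (t - j)) * f (t - (t - j)) : ℝ) =
      (2 * D + t) * ∑ j ∈ Finset.range (t + 1), t.choose j * f j * f (t - j) := by
    rw [← Finset.sum_add_distrib, Finset.mul_sum]
    refine Finset.sum_congr rfl fun j hj => ?_
    have hj' : j ≤ t := Nat.lt_succ_iff.mp (Finset.mem_range.mp hj)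
    rw [Nat.choose_symm hj', Nat.sub_sub_self hj', Nat.cast_sub hj']
    ring
  rw [h] at h2
  linarith

omit [Nonempty ι] [Nonempty κ] in
theorem card_eq_two_mul (e : κ ≃ Fin 2 × ι) : Fintype.card κ = 2 * Fintype.card ι := by
  rw [Fintype.card_congr e, Fintype.card_prod, Fintype.card_fin]

theorem integrable_prod_of_homogCont {n : ℕ} (e : κ ≃ Fin 2 × ι) {F : EuclideanSpace ℂ κ → ℂ}
    (hF : HomogCont n F) :
    Integrable (fun z => F (stack e z)) ((gaussian ι).prod (gaussian ι)) := by
  have h := hF.integrable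
  rw [gaussian_eq_smul_map_stack e] at h
  replace h := (integrable_smul_measure (c := (stackConst e : ENNReal))
    (ENNReal.coe_ne_zero.mpr (stackConst_ne_zero e)) ENNReal.coe_ne_top).mp h
  exact h.comp_measurable (continuous_stack e).measurable

variable [DecidableEq ι] [DecidableEq κ] {n : ℕ}

/-- The block of a matrix in which the qubit of the first register is projected on `⟨b|` and
`|b'⟩`. -/
def qubitBlock (e : κ ≃ Fin 2 × ι) {τ : Type} [Fintype τ] [DecidableEq τ] (b b' : Fin 2)
    (A : Matrix (κ × τ) (κ × τ) ℂ) : Matrix (ι × τ) (ι × τ) ℂ :=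
  (qubitBra e b ⊗ₖ (1 : Matrix τ τ ℂ)) * A * (qubitBra e b' ⊗ₖ (1 : Matrix τ τ ℂ))ᴴ

omit [Fintype ι] [DecidableEq ι] [Nonempty ι] [Nonempty κ] in
theorem qubitBlock_kronecker (e : κ ≃ Fin 2 × ι) {τ : Type} [Fintype τ] [DecidableEq τ]
    (b b' : Fin 2) (A : Matrix κ κ ℂ) (B : Matrix τ τ ℂ) :
    qubitBlock e b b' (A ⊗ₖ B) = (qubitBra e b * A * (qubitBra e b')ᴴ) ⊗ₖ B := by
  rw [qubitBlock, conjTranspose_kronecker, ← mul_kronecker_mul, ← mul_kronecker_mul,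
    conjTranspose_one, Matrix.one_mul, Matrix.mul_one]

omit [Nonempty ι] [Nonempty κ] in
theorem qubitBra_mul_keyChannel (e : κ ≃ Fin 2 × ι) (U : (Fin n → Bool) → Matrix ι ι ℂ) (b : Fin 2)
    (A : Matrix κ κ ℂ) :
    qubitBra e b * keyChannel (fun k => qubitTensor e 1 (U k)) A * (qubitBra e b)ᴴ =
      keyChannel U (qubitBra e b * A * (qubitBra e b)ᴴ) := by
  rw [keyChannel, ← keyExp_mul_mul, keyChannel]
  congr 1
  funext k
  have h := qubitBra_mul_qubitTensor_one e b (U k)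
  calc _ = (qubitBra e b * qubitTensor e 1 (U k)) * A *
        (qubitBra e b * qubitTensor e 1 (U k))ᴴ := by
        rw [conjTranspose_mul]; simp only [Matrix.mul_assoc]
    _ = _ := by rw [h, conjTranspose_mul]; simp only [Matrix.mul_assoc]

omit [Nonempty κ] in
theorem qubitBlock_keyState_sub_mixedState (e : κ ≃ Fin 2 × ι) (U : (Fin n → Bool) → Matrix ι ι ℂ)
    (t : ℕ) {c : ℂ} (hc : c * Fintype.card ι = Fintype.card ι + (t / 2 : ℝ))
    (z : EuclideanSpace ℂ ι × EuclideanSpace ℂ ι) :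
    qubitBlock e 0 0 (keyState (fun k => qubitTensor e 1 (U k)) t (stack e z) -
      ((Fintype.card κ + t : ℝ) : ℂ) • mixedState t (stack e z)) =
    (keyChannel U (vecMulVec z.1.ofLp (star z.1.ofLp)) - c • 1) ⊗ₖ
      vecMulVec (tpow t (stack e z).ofLp) (star (tpow t (stack e z).ofLp)) := by
  set V := fun k => qubitTensor e 1 (U k)
  have hD : (Fintype.card ι : ℂ) ≠ 0 := by exact_mod_cast Fintype.card_ne_zero
  have h4 : keyState V t (stack e z) - ((Fintype.card κ + t : ℝ) : ℂ) • mixedState t (stack e z) =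
      (keyChannel V (vecMulVec (stack e z).ofLp (star (stack e z).ofLp)) - c • 1) ⊗ₖ
        vecMulVec (tpow t (stack e z).ofLp) (star (tpow t (stack e z).ofLp)) := by
    ext x y
    simp only [keyState, mixedState, tensorPow_vecMulVec, tpow_star, Matrix.sub_apply,
      Matrix.smul_apply, kroneckerMap_apply, smul_eq_mul]
    -- The factor `card κ + t` is the moment ratio compensating the degree gap between `keyState`
    -- and `mixedState`; divided by `card κ` it is `c`.
    have h5 : ((Fintype.card κ + t : ℝ) : ℂ) = 2 * (c * Fintype.card ι) := by
      rw [hc, card_eq_two_mul e]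
      push_cast
      ring
    rw [h5, card_eq_two_mul e]
    push_cast
    field_simp
  rw [h4, qubitBlock_kronecker, Matrix.mul_sub, Matrix.sub_mul, qubitBra_mul_keyChannel,
    mul_vecMulVec_mul_conjTranspose, qubitBra_mulVec_stack, Matrix.mul_smul, Matrix.smul_mul,
    Matrix.mul_one, qubitBra_mul_conjTranspose, if_pos rfl]

theorem matIntegrable_stack (e : κ ≃ Fin 2 × ι) (U : (Fin n → Bool) → Matrix ι ι ℂ)
    (t : ℕ) {c : ℂ} (hc : c * Fintype.card ι = Fintype.card ι + (t / 2 : ℝ)) :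
    MatIntegrable ((gaussian ι).prod (gaussian ι)) fun z =>
      (keyChannel U (vecMulVec z.1.ofLp (star z.1.ofLp)) - c • 1) ⊗ₖ
        vecMulVec (tpow t (stack e z).ofLp) (star (tpow t (stack e z).ofLp)) := by
  simp only [← qubitBlock_keyState_sub_mixedState e U t hc]
  refine MatIntegrable.mul_mul (fun x y => ?_) _ _
  exact (integrable_prod_of_homogCont e (homogMat_keyState _ t x y)).sub
    (integrable_prod_of_homogCont e ((homogMat_mixedState t).smul _ x y))

/-- The first diagonal block of the defect, as a Gaussian integral over both qubit components. -/
theorem smul_qubitBlock_defect (e : κ ≃ Fin 2 × ι) (U : (Fin n → Bool) → Matrix ι ι ℂ) (t : ℕ)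
    {c : ℂ} (hc : c * Fintype.card ι = Fintype.card ι + (t / 2 : ℝ)) :
    (gaussianMoment κ (t + 1) : ℂ) •
      qubitBlock e 0 0 (defect (fun k => qubitTensor e 1 (U k)) t) =
    (stackConst e : ℂ) • matInt ((gaussian ι).prod (gaussian ι)) fun z =>
      (keyChannel U (vecMulVec z.1.ofLp (star z.1.ofLp)) - c • 1) ⊗ₖ
        vecMulVec (tpow t (stack e z).ofLp) (star (tpow t (stack e z).ofLp)) := by
  simp only [← qubitBlock_keyState_sub_mixedState e U t hc]
  set V := fun k => qubitTensor e 1 (U k)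
  have h1 : (gaussianMoment κ (t + 1) : ℂ) • defect V t =
      matInt (gaussian κ) fun x => keyState V t x -
        ((Fintype.card κ + t : ℝ) : ℂ) • mixedState t x := by
    rw [matInt_sub (homogMat_keyState V t).matIntegrable
      ((homogMat_mixedState t).smul _).matIntegrable, matInt_smul,
      (homogMat_keyState V t).matInt_gaussian, (homogMat_mixedState t).matInt_gaussian, defect,
      smul_sub, smul_smul, gaussianMoment_succ, Complex.ofReal_mul]
  have h2 : MatIntegrable (gaussian κ) fun x => keyState V t x -
        ((Fintype.card κ + t : ℝ) : ℂ) • mixedState t x := fun x y =>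
    ((homogMat_keyState V t).matIntegrable x y).sub
      (((homogMat_mixedState t).smul _).matIntegrable x y)
  rw [qubitBlock, ← Matrix.smul_mul, ← Matrix.mul_smul, h1, ← matInt_mul_mul h2]
  ext x y
  have h3 := integral_gaussian_stack e fun g : EuclideanSpace ℂ κ =>
    qubitBlock e 0 0 (keyState V t g - ((Fintype.card κ + t : ℝ) : ℂ) • mixedState t g) x y
  rw [Complex.real_smul] at h3
  exact h3

omit [Fintype κ] [Nonempty ι] [Nonempty κ] [DecidableEq κ] in
theorem pairState_stack_eq_sum (e : κ ≃ Fin 2 × ι) (U : (Fin n → Bool) → Matrix ι ι ℂ) (t : ℕ)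
    (c : ℂ) (z : EuclideanSpace ℂ ι × EuclideanSpace ℂ ι) :
    (keyChannel U (vecMulVec z.1.ofLp (star z.1.ofLp)) - c • 1) ⊗ₖ
        vecMulVec (tpow t (stack e z).ofLp) (star (tpow t (stack e z).ofLp)) =
      ∑ j ∈ Finset.range (t + 1), ∑ j' ∈ Finset.range (t + 1),
        ((1 : Matrix ι ι ℂ) ⊗ₖ interleave e t j z.2.ofLp) * pairState U c j j' z.1 *
          ((1 : Matrix ι ι ℂ) ⊗ₖ interleave e t j' z.2.ofLp)ᴴ := by
  simp only [pairState, conjTranspose_kronecker, conjTranspose_one, ← mul_kronecker_mul,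
    Matrix.one_mul, Matrix.mul_one, mul_vecMulVec_mul_conjTranspose]
  rw [tpow_stack]
  ext x y
  simp only [kroneckerMap_apply, vecMulVec_apply, Matrix.sum_apply, Finset.sum_apply,
    Pi.star_apply, star_sum]
  rw [Finset.sum_mul_sum, Finset.mul_sum]
  simp only [Finset.mul_sum]

theorem traceNorm_qubitBlock_defect_le (e : κ ≃ Fin 2 × ι) (U : (Fin n → Bool) → Matrix ι ι ℂ)
    (t : ℕ) :
    traceNorm (qubitBlock e 0 0 (defect (fun k => qubitTensor e 1 (U k)) t)) ≤
      traceNorm (defect U t) / 2 + t / (2 * Fintype.card κ) := by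
  have hD : (Fintype.card ι : ℂ) ≠ 0 := by exact_mod_cast Fintype.card_ne_zero
  obtain ⟨c, hc⟩ : ∃ c : ℂ, c * Fintype.card ι = Fintype.card ι + (t / 2 : ℝ) :=
    ⟨_, div_mul_cancel₀ _ hD⟩
  set ε := traceNorm (defect U t) with hε
  set M : EuclideanSpace ℂ ι × EuclideanSpace ℂ ι →
      Matrix (ι × (Fin t → κ)) (ι × (Fin t → κ)) ℂ := fun z =>
    (keyChannel U (vecMulVec z.1.ofLp (star z.1.ofLp)) - c • 1) ⊗ₖ
      vecMulVec (tpow t (stack e z).ofLp) (star (tpow t (stack e z).ofLp)) with hM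
  have hMint : MatIntegrable ((gaussian ι).prod (gaussian ι)) M := matIntegrable_stack e U t hc
  -- The first component is integrated with the second fixed: the `interleave` factors depend only
  -- on the latter and leave the inner integral.
  have hfub : matInt ((gaussian ι).prod (gaussian ι)) M =
      matInt (gaussian ι) fun y => matInt (gaussian ι) fun x => M (x, y) := by
    ext x y
    exact integral_prod_symm _ (hMint x y)
  have hInt : MatIntegrable (gaussian ι) fun y => matInt (gaussian ι) fun x => M (x, y) :=
    fun x y => (hMint x y).integral_prod_right
  have hinner : ∀ y, (matInt (gaussian ι) fun x => M (x, y)) =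
      ∑ j ∈ Finset.range (t + 1), ((1 : Matrix ι ι ℂ) ⊗ₖ interleave e t j y.ofLp) *
        matInt (gaussian ι) (pairState U c j j) *
        ((1 : Matrix ι ι ℂ) ⊗ₖ interleave e t j y.ofLp)ᴴ := by
    intro y
    simp only [hM, pairState_stack_eq_sum]
    rw [matInt_sum fun j _ => MatIntegrable.sum fun j' _ =>
      (matIntegrable_pairState U c j j').mul_mul _ _]
    refine Finset.sum_congr rfl fun j hj => ?_
    rw [matInt_sum fun j' _ => (matIntegrable_pairState U c j j').mul_mul _ _,
      Finset.sum_eq_single_of_mem j hj]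
    · exact matInt_mul_mul (matIntegrable_pairState U c j j) _ _
    · intro j' _ hj'
      rw [matInt_mul_mul (matIntegrable_pairState U c j j'), matInt_pairState_of_ne U c hj'.symm,
        Matrix.mul_zero, Matrix.zero_mul]
  have hbound : ∀ y, traceNorm (matInt (gaussian ι) fun x => M (x, y)) ≤
      ∑ j ∈ Finset.range (t + 1), (t.choose j * (gaussianMoment ι (j + 1) * ε +
        gaussianMoment ι j * (t / 2))) * ‖y‖ ^ (2 * (t - j)) := by
    intro y
    rw [hinner]
    refine (traceNorm_sum_le _ _).trans (Finset.sum_le_sum fun j hj => ?_)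
    have hj' : j ≤ t := Nat.lt_succ_iff.mp (Finset.mem_range.mp hj)
    refine (traceNorm_conj_le (c := t.choose j * ‖y‖ ^ (2 * (t - j))) (by positivity) ?_ _).trans ?_
    · rw [conjTranspose_kronecker, ← mul_kronecker_mul, interleave_conjTranspose_mul_self,
        conjTranspose_one, Matrix.one_mul, kronecker_smul, one_kronecker_one]
    · calc _ ≤ (t.choose j * ‖y‖ ^ (2 * (t - j))) * (gaussianMoment ι (j + 1) * ε +
            gaussianMoment ι j * (t / 2)) :=
          mul_le_mul_of_nonneg_left (traceNorm_matInt_pairState_le U hc hj') (by positivity)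
        _ = _ := by ring
  have hM_le : traceNorm (matInt ((gaussian ι).prod (gaussian ι)) M) ≤
      ∑ j ∈ Finset.range (t + 1), (t.choose j * (gaussianMoment ι (j + 1) * ε +
        gaussianMoment ι j * (t / 2))) * gaussianMoment ι (t - j) := by
    rw [hfub]
    have hterm : ∀ j ∈ Finset.range (t + 1), Integrable (fun y : EuclideanSpace ℂ ι =>
        (t.choose j * (gaussianMoment ι (j + 1) * ε + gaussianMoment ι j * (t / 2))) *
          ‖y‖ ^ (2 * (t - j))) (gaussian ι) := fun j _ =>
      (integrable_norm_pow_gaussian _).const_mul _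
    refine (traceNorm_matInt_le hInt (integrable_finsetSum _ hterm) hbound).trans_eq ?_
    rw [integral_finsetSum _ hterm]
    exact Finset.sum_congr rfl fun j _ => integral_const_mul _ _
  set S := ∑ j ∈ Finset.range (t + 1), t.choose j * gaussianMoment ι j * gaussianMoment ι (t - j)
    with hS
  have hsum : ∑ j ∈ Finset.range (t + 1), (t.choose j * (gaussianMoment ι (j + 1) * ε +
      gaussianMoment ι j * (t / 2))) * gaussianMoment ι (t - j) =
      ((Fintype.card ι + t / 2) * ε + t / 2) * S := by
    have h := sum_choose_mul_succ_eq (Fintype.card ι) t (gaussianMoment ι)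
    simp only [← gaussianMoment_succ] at h
    rw [add_mul, mul_right_comm, ← h, hS, Finset.sum_mul, Finset.mul_sum,
      ← Finset.sum_add_distrib]
    refine Finset.sum_congr rfl fun j _ => ?_
    ring
  have hκ : gaussianMoment κ t = stackConst e * S := gaussianMoment_stack e t
  have hcard : (Fintype.card κ : ℝ) = 2 * Fintype.card ι := by
    exact_mod_cast card_eq_two_mul e
  have hmain := congrArg traceNorm (smul_qubitBlock_defect e U t hc)
  rw [traceNorm_smul, traceNorm_smul, Complex.norm_real, Complex.norm_real,
    Real.norm_of_nonneg (gaussianMoment_pos _).le, Real.norm_of_nonneg NNReal.zero_le_coe] at hmain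
  have hle := mul_le_mul_of_nonneg_left (hM_le.trans_eq hsum) (NNReal.zero_le_coe (q := stackConst e))
  rw [← hmain, mul_left_comm, ← hκ, gaussianMoment_succ, mul_assoc] at hle
  set T := traceNorm (qubitBlock e 0 0 (defect (fun k => qubitTensor e 1 (U k)) t))
  -- Both sides carry the factor `stackConst e * S = gaussianMoment κ t`, which is cancelled.
  have hle2 : (2 * Fintype.card ι + t) * T ≤ (Fintype.card ι + t / 2) * ε + t / 2 := by
    refine le_of_mul_le_mul_right ?_ (gaussianMoment_pos (ι := κ) t)
    rw [← hcard]
    linarith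
  have ht : (0 : ℝ) ≤ t := t.cast_nonneg
  have hA : (0 : ℝ) < 2 * Fintype.card ι + t := by positivity
  have h1 : T ≤ ε / 2 + t / 2 / (2 * Fintype.card ι + t) := by
    rw [← sub_le_iff_le_add', le_div_iff₀ hA]
    linarith
  have h2 : (t : ℝ) / 2 / (2 * Fintype.card ι + t) ≤ t / (2 * Fintype.card κ) := by
    rw [div_div, hcard]
    gcongr
    linarith
  exact h1.trans (add_le_add_right h2 _)

end Block

/-! ### Invariance under unitaries commuting with the keyed operators -/

section Invariance

variable {κ : Type} [Fintype κ] [DecidableEq κ] [Nonempty κ] {n : ℕ}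

/-- Invariance is transported from the Gaussian measure by dividing out the nonzero moment. -/
theorem mul_matInt_haarState_mul {σ : Type} [Fintype σ] {p : ℕ} (W : unitaryGroup κ ℂ)
    {M : EuclideanSpace ℂ κ → Matrix σ σ ℂ} (hM : HomogMat (2 * p) M) (L R : Matrix σ σ ℂ)
    (h : ∀ x, M (unitaryIsometry W x) = L * M x * R) :
    L * (matInt (haarState κ) fun ψ : PureState κ => M ψ.1) * R =
      matInt (haarState κ) fun ψ : PureState κ => M ψ.1 := by
  have hN : (gaussianMoment κ p : ℂ) ≠ 0 := by exact_mod_cast (gaussianMoment_pos p).ne'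
  have h1 : matInt (gaussian κ) (fun x => L * M x * R) = matInt (gaussian κ) M := by
    simp only [← h]
    ext x y
    exact integral_gaussian_unitary W fun g => M g x y
  rw [matInt_mul_mul hM.matIntegrable, hM.matInt_gaussian, Matrix.mul_smul, Matrix.smul_mul] at h1
  exact smul_right_injective _ hN h1

omit [Nonempty κ] in
theorem ofLp_unitaryIsometry (W : unitaryGroup κ ℂ) (x : EuclideanSpace ℂ κ) :
    (unitaryIsometry W x).ofLp = W.1 *ᵥ x.ofLp := rfl

theorem tensorPow_conj {σ : Type} [Fintype σ] (W A : Matrix σ σ ℂ) (t : ℕ) :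
    tensorPow (W * A * Wᴴ) t = tensorPow W t * tensorPow A t * (tensorPow W t)ᴴ := by
  rw [tensorPow_mul, tensorPow_mul, tensorPow_conjTranspose]

/-- The defect is invariant under a unitary acting on all registers that commutes with the
key-dependent operators. -/
theorem conj_defect (V : (Fin n → Bool) → Matrix κ κ ℂ) (t : ℕ) (W : unitaryGroup κ ℂ)
    (hW : ∀ k, V k * W.1 = W.1 * V k) :
    (W.1 ⊗ₖ tensorPow W.1 t) * defect V t * (W.1 ⊗ₖ tensorPow W.1 t)ᴴ = defect V t := by
  have hproj : ∀ x : EuclideanSpace ℂ κ,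
      vecMulVec (unitaryIsometry W x).ofLp (star (unitaryIsometry W x).ofLp) =
        W.1 * vecMulVec x.ofLp (star x.ofLp) * W.1ᴴ := fun x => by
    rw [mul_vecMulVec_mul_conjTranspose, ofLp_unitaryIsometry]
  have hWW : W.1 * W.1ᴴ = 1 := mem_unitaryGroup_iff.mp W.2
  rw [defect, Matrix.mul_sub, Matrix.sub_mul]
  congr 1
  · refine mul_matInt_haarState_mul W (homogMat_keyState V t) _ _ fun x => ?_
    rw [keyState, keyState, hproj, conjTranspose_kronecker, ← mul_kronecker_mul,
      ← mul_kronecker_mul, tensorPow_conj, keyChannel, keyChannel, ← keyExp_mul_mul]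
    congr 2
    funext k
    calc _ = (V k * W.1) * vecMulVec x.ofLp (star x.ofLp) * (V k * W.1)ᴴ := by
          rw [conjTranspose_mul]; simp only [Matrix.mul_assoc]
      _ = _ := by rw [hW, conjTranspose_mul]; simp only [Matrix.mul_assoc]
  · refine mul_matInt_haarState_mul W (homogMat_mixedState t) _ _ fun x => ?_
    rw [mixedState, mixedState, hproj, conjTranspose_kronecker, ← mul_kronecker_mul,
      ← mul_kronecker_mul, tensorPow_conj, Matrix.mul_smul, Matrix.smul_mul, Matrix.mul_one, hWW]

end Invariance

/-! ### From one diagonal block to the whole operator -/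

section Polarization

variable {ι κ : Type} [Fintype ι] [Fintype κ] [DecidableEq ι] [DecidableEq κ] {n : ℕ}

omit [DecidableEq ι] [DecidableEq κ] in
theorem qubitTensor_mul (e : κ ≃ Fin 2 × ι) (w w' : Matrix (Fin 2) (Fin 2) ℂ)
    (U U' : Matrix ι ι ℂ) :
    qubitTensor e w U * qubitTensor e w' U' = qubitTensor e (w * w') (U * U') := by
  rw [qubitTensor, qubitTensor, submatrix_mul_equiv, ← mul_kronecker_mul, qubitTensor]

theorem qubitTensor_mem_unitaryGroup (e : κ ≃ Fin 2 × ι) {w : Matrix (Fin 2) (Fin 2) ℂ}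
    (hw : w ∈ unitaryGroup (Fin 2) ℂ) : qubitTensor e w (1 : Matrix ι ι ℂ) ∈ unitaryGroup κ ℂ := by
  rw [mem_unitaryGroup_iff] at hw ⊢
  have h : star (qubitTensor e w (1 : Matrix ι ι ℂ)) = qubitTensor e (star w) 1 := by
    rw [qubitTensor, star_eq_conjTranspose, conjTranspose_submatrix, conjTranspose_kronecker,
      conjTranspose_one, qubitTensor, star_eq_conjTranspose]
  rw [h, qubitTensor_mul, hw, Matrix.one_mul, qubitTensor, one_kronecker_one, submatrix_one_equiv]

/-- Every diagonal block of the defect with respect to a basis of the qubit has the same trace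
norm bound. -/
theorem traceNorm_rotated_block_le [Nonempty κ] (e : κ ≃ Fin 2 × ι)
    (U : (Fin n → Bool) → Matrix ι ι ℂ) (t : ℕ) {w : Matrix (Fin 2) (Fin 2) ℂ}
    (hw : w ∈ unitaryGroup (Fin 2) ℂ) :
    traceNorm (((qubitBra e 0 * qubitTensor e w 1) ⊗ₖ (1 : Matrix (Fin t → κ) (Fin t → κ) ℂ)) *
      defect (fun k => qubitTensor e 1 (U k)) t *
      ((qubitBra e 0 * qubitTensor e w 1) ⊗ₖ (1 : Matrix (Fin t → κ) (Fin t → κ) ℂ))ᴴ) ≤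
    traceNorm (qubitBlock e 0 0 (defect (fun k => qubitTensor e 1 (U k)) t)) := by
  set V := fun k => qubitTensor e 1 (U k) with hV
  let W : unitaryGroup κ ℂ := ⟨qubitTensor e w 1, qubitTensor_mem_unitaryGroup e hw⟩
  have hinv : (star W.1 ⊗ₖ tensorPow (star W.1) t) * defect V t *
      (star W.1 ⊗ₖ tensorPow (star W.1) t)ᴴ = defect V t := by
    refine conj_defect V t (star W) fun k => ?_
    have h : star W.1 = qubitTensor e (star w) 1 := by
      change star (qubitTensor e w (1 : Matrix ι ι ℂ)) = _
      rw [qubitTensor, star_eq_conjTranspose, conjTranspose_submatrix, conjTranspose_kronecker,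
        conjTranspose_one, qubitTensor, star_eq_conjTranspose]
    change V k * star W.1 = star W.1 * V k
    rw [h, hV, qubitTensor_mul, qubitTensor_mul]
    simp
  have hWW : W.1 * star W.1 = 1 := mem_unitaryGroup_iff.mp W.2
  set T := tensorPow (star W.1) t with hT
  have hTT : Tᴴ * T = 1 := by
    rw [hT, ← tensorPow_conjTranspose, ← tensorPow_mul, star_eq_conjTranspose,
      conjTranspose_conjTranspose, ← star_eq_conjTranspose, hWW, tensorPow_one]
  have hL : ((qubitBra e 0 * W.1) ⊗ₖ (1 : Matrix (Fin t → κ) (Fin t → κ) ℂ)) *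
      (star W.1 ⊗ₖ T) = ((1 : Matrix ι ι ℂ) ⊗ₖ T) *
        (qubitBra e 0 ⊗ₖ (1 : Matrix (Fin t → κ) (Fin t → κ) ℂ)) := by
    rw [← mul_kronecker_mul, ← mul_kronecker_mul, Matrix.mul_assoc, hWW, Matrix.one_mul,
      Matrix.one_mul, Matrix.mul_one, Matrix.mul_one]
  have key : ((qubitBra e 0 * W.1) ⊗ₖ (1 : Matrix (Fin t → κ) (Fin t → κ) ℂ)) * defect V t *
      ((qubitBra e 0 * W.1) ⊗ₖ (1 : Matrix (Fin t → κ) (Fin t → κ) ℂ))ᴴ =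
      ((1 : Matrix ι ι ℂ) ⊗ₖ T) * qubitBlock e 0 0 (defect V t) * ((1 : Matrix ι ι ℂ) ⊗ₖ T)ᴴ := by
    -- Applying `star W` to all registers cancels the rotation of the first one; what is left acts
    -- on the other `t` registers and cannot increase the trace norm.
    conv_lhs => rw [← hinv]
    set A := (qubitBra e 0 * W.1) ⊗ₖ (1 : Matrix (Fin t → κ) (Fin t → κ) ℂ)
    set B := star W.1 ⊗ₖ T
    calc _ = (A * B) * defect V t * (A * B)ᴴ := by
          rw [conjTranspose_mul]; simp only [Matrix.mul_assoc]
      _ = _ := by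
          rw [hL, conjTranspose_mul, qubitBlock]; simp only [Matrix.mul_assoc]
  change traceNorm (((qubitBra e 0 * W.1) ⊗ₖ (1 : Matrix (Fin t → κ) (Fin t → κ) ℂ)) * _ *
      ((qubitBra e 0 * W.1) ⊗ₖ (1 : Matrix (Fin t → κ) (Fin t → κ) ℂ))ᴴ) ≤ _
  rw [key]
  refine (traceNorm_conj_le zero_le_one ?_ _).trans_eq (one_mul _)
  rw [conjTranspose_kronecker, ← mul_kronecker_mul, hTT, conjTranspose_one, Matrix.one_mul,
    one_kronecker_one, Complex.ofReal_one, one_smul]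

/-- A matrix is the sum of its four blocks with respect to the qubit of the first register. -/
theorem traceNorm_le_sum_qubitBlock (e : κ ≃ Fin 2 × ι) {τ : Type} [Fintype τ] [DecidableEq τ]
    (A : Matrix (κ × τ) (κ × τ) ℂ) :
    traceNorm A ≤ ∑ b, ∑ b', traceNorm (qubitBlock e b b' A) := by
  set R : Fin 2 → Matrix (ι × τ) (κ × τ) ℂ := fun b => qubitBra e b ⊗ₖ (1 : Matrix τ τ ℂ) with hR
  have h1 : ∑ b, (R b)ᴴ * R b = 1 := by
    simp only [hR, conjTranspose_kronecker, ← mul_kronecker_mul, conjTranspose_one, Matrix.one_mul]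
    rw [← one_kronecker_one, ← sum_conjTranspose_mul_qubitBra e]
    ext x y
    simp only [Matrix.sum_apply, kroneckerMap_apply, Finset.sum_mul]
  have h2 : ∀ b, R b * (R b)ᴴ = 1 := fun b => by
    simp only [hR, conjTranspose_kronecker, ← mul_kronecker_mul, conjTranspose_one, Matrix.one_mul]
    rw [qubitBra_mul_conjTranspose, if_pos rfl, one_kronecker_one]
  have h3 : A = ∑ b, ∑ b', (R b)ᴴ * qubitBlock e b b' A * R b' := by
    conv_lhs => rw [← Matrix.one_mul A, ← Matrix.mul_one (1 * A), ← h1]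
    simp only [Matrix.sum_mul, Matrix.mul_sum, qubitBlock, hR, Matrix.mul_assoc]
    exact Finset.sum_comm
  conv_lhs => rw [h3]
  refine (traceNorm_sum_le _ _).trans (Finset.sum_le_sum fun b _ => ?_)
  refine (traceNorm_sum_le _ _).trans (Finset.sum_le_sum fun b' _ => ?_)
  exact traceNorm_mul_mul_conjTranspose_le_of_coisometry (h2 b) (h2 b') _

/-- Polarization: an off-diagonal block is controlled by the rotated diagonal blocks. -/
theorem traceNorm_mul_mul_conjTranspose_le_of_polarization {ν : Type} [Fintype ν]
    [DecidableEq ν] {ρ : Type} [Fintype ρ]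
    (A : Matrix ρ ρ ℂ) (R₀ R₁ : Matrix ν ρ ℂ) {c : ℝ}
    (h : ∀ w : ℂ, w * star w = 1 →
      traceNorm ((R₀ + w • R₁) * A * (R₀ + w • R₁)ᴴ) ≤ 2 * c) :
    traceNorm (R₀ * A * R₁ᴴ) ≤ 2 * c := by
  -- The phases `1, i, -1, -i` average out every term except the one sesquilinear in `R₀` and `R₁`.
  have h4 : R₀ * A * R₁ᴴ = (1 / 4 : ℂ) • (
      (R₀ + (1 : ℂ) • R₁) * A * (R₀ + (1 : ℂ) • R₁)ᴴ +
      Complex.I • ((R₀ + Complex.I • R₁) * A * (R₀ + Complex.I • R₁)ᴴ) +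
      (-1 : ℂ) • ((R₀ + (-1 : ℂ) • R₁) * A * (R₀ + (-1 : ℂ) • R₁)ᴴ) +
      (-Complex.I) • ((R₀ + (-Complex.I) • R₁) * A * (R₀ + (-Complex.I) • R₁)ᴴ)) := by
    simp only [conjTranspose_add, conjTranspose_smul, Matrix.add_mul, Matrix.mul_add,
      Matrix.smul_mul, Matrix.mul_smul, smul_add, smul_smul, star_one, star_neg, Complex.star_def,
      Complex.conj_I]
    ext x y
    simp only [Matrix.add_apply, Matrix.smul_apply, smul_eq_mul]
    linear_combination (1 / 2 * ((R₀ * A * R₁ᴴ) x y) - 1 / 2 * (R₁ * A * R₀ᴴ) x y) * Complex.I_sq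
  have hI : Complex.I * star Complex.I = 1 := by simp
  have hnI : -Complex.I * star (-Complex.I) = 1 := by simp
  have b1 := h 1 (by simp)
  have b2 := h Complex.I hI
  have b3 := h (-1) (by simp)
  have b4 := h (-Complex.I) hnI
  rw [h4]
  refine (traceNorm_smul_le _ _).trans ?_
  have hsum := (traceNorm_add_le _ _).trans (add_le_add ((traceNorm_add_le _ _).trans
    (add_le_add ((traceNorm_add_le _ _).trans (add_le_add b1
      ((traceNorm_smul_le Complex.I _).trans_eq (by rw [Complex.norm_I, one_mul]) |>.trans b2)))
      ((traceNorm_smul_le (-1 : ℂ) _).trans_eq (by rw [norm_neg, norm_one, one_mul]) |>.trans b3)))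
      ((traceNorm_smul_le (-Complex.I) _).trans_eq
        (by rw [norm_neg, Complex.norm_I, one_mul]) |>.trans b4))
  refine (mul_le_mul_of_nonneg_left hsum (norm_nonneg _)).trans_eq ?_
  norm_num
  ring

theorem rotation_mem_unitaryGroup {a b : ℂ} (ha : a * star a = 1) (hb : b * star b = 1) :
    ((√2 : ℝ) : ℂ)⁻¹ • !![a, b; a, -b] ∈ unitaryGroup (Fin 2) ℂ := by
  have h2 : ((√2 : ℝ) : ℂ) * ((√2 : ℝ) : ℂ) = 2 := by
    rw [← Complex.ofReal_mul, Real.mul_self_sqrt zero_le_two, Complex.ofReal_ofNat]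
  have h3 : ((√2 : ℝ) : ℂ)⁻¹ * star ((√2 : ℝ) : ℂ)⁻¹ = 2⁻¹ := by
    rw [star_inv₀, Complex.star_def, Complex.conj_ofReal, ← mul_inv, h2]
  rw [mem_unitaryGroup_iff, star_smul, Matrix.smul_mul, Matrix.mul_smul, smul_smul, h3]
  rw [Complex.star_def] at ha hb
  ext i j
  fin_cases i <;> fin_cases j <;>
    simp [vecMul, dotProduct, Fin.sum_univ_two, star_eq_conjTranspose, conjTranspose_apply, ha,
      hb] <;>
    norm_num

/-- The bra `a⟨0| + b⟨1|` is `√2` times the first row of a unitary; the scalar enters on both sides,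
hence the factor `2`. -/
theorem traceNorm_combination_le [Nonempty κ] (e : κ ≃ Fin 2 × ι)
    (U : (Fin n → Bool) → Matrix ι ι ℂ) (t : ℕ) {a b : ℂ} (ha : a * star a = 1)
    (hb : b * star b = 1) :
    traceNorm (((a • qubitBra e 0 + b • qubitBra e 1) ⊗ₖ
        (1 : Matrix (Fin t → κ) (Fin t → κ) ℂ)) *
      defect (fun k => qubitTensor e 1 (U k)) t *
      ((a • qubitBra e 0 + b • qubitBra e 1) ⊗ₖ (1 : Matrix (Fin t → κ) (Fin t → κ) ℂ))ᴴ) ≤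
    2 * traceNorm (qubitBlock e 0 0 (defect (fun k => qubitTensor e 1 (U k)) t)) := by
  have hs : ((√2 : ℝ) : ℂ) ≠ 0 := by
    exact_mod_cast (Real.sqrt_pos.mpr zero_lt_two).ne'
  have h := traceNorm_rotated_block_le e U t (rotation_mem_unitaryGroup ha hb)
  have h1 : a • qubitBra e 0 + b • qubitBra e 1 = ((√2 : ℝ) : ℂ) •
      (qubitBra e 0 * qubitTensor e (((√2 : ℝ) : ℂ)⁻¹ • !![a, b; a, -b]) (1 : Matrix ι ι ℂ)) := by
    rw [qubitBra_mul_qubitTensor, Fin.sum_univ_two]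
    simp [smul_smul, hs]
  rw [h1, smul_kronecker, conjTranspose_smul, Matrix.smul_mul, Matrix.smul_mul, Matrix.mul_smul,
    smul_smul]
  refine (traceNorm_smul_le _ _).trans (mul_le_mul ?_ h (traceNorm_nonneg _) zero_le_two)
  rw [Complex.star_def, Complex.conj_ofReal, ← Complex.ofReal_mul, Real.mul_self_sqrt zero_le_two]
  simp

theorem traceNorm_defect_le_six_mul [Nonempty κ] (e : κ ≃ Fin 2 × ι)
    (U : (Fin n → Bool) → Matrix ι ι ℂ) (t : ℕ) :
    traceNorm (defect (fun k => qubitTensor e 1 (U k)) t) ≤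
      6 * traceNorm (qubitBlock e 0 0 (defect (fun k => qubitTensor e 1 (U k)) t)) := by
  set Δ := defect (fun k => qubitTensor e 1 (U k)) t with hΔ
  set c := traceNorm (qubitBlock e 0 0 Δ) with hc
  have h11 : traceNorm (qubitBlock e 1 1 Δ) ≤ c := by
    -- The bit flip exchanges the two diagonal blocks.
    have h := traceNorm_rotated_block_le e U t (w := !![0, 1; 1, 0]) (by
      rw [mem_unitaryGroup_iff]
      ext i j
      fin_cases i <;> fin_cases j <;>
        simp [Matrix.mul_apply, Fin.sum_univ_two, star_eq_conjTranspose, conjTranspose_apply])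
    rw [qubitBra_mul_qubitTensor, Fin.sum_univ_two] at h
    simpa [qubitBlock, hc, hΔ] using h
  have h01 : traceNorm (qubitBlock e 0 1 Δ) ≤ 2 * c := by
    refine traceNorm_mul_mul_conjTranspose_le_of_polarization _ _ _ fun w hw => ?_
    have h := traceNorm_combination_le e U t (a := 1) (b := w) (by simp) hw
    rwa [add_kronecker, smul_kronecker, smul_kronecker, one_smul] at h
  have h10 : traceNorm (qubitBlock e 1 0 Δ) ≤ 2 * c := by
    refine traceNorm_mul_mul_conjTranspose_le_of_polarization _ _ _ fun w hw => ?_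
    have h := traceNorm_combination_le e U t (a := w) (b := 1) hw (by simp)
    rwa [add_comm, add_kronecker, smul_kronecker, smul_kronecker, one_smul] at h
  refine (traceNorm_le_sum_qubitBlock e Δ).trans ?_
  simp only [Fin.sum_univ_two]
  linarith

end Polarization

/-! ### Assembling the bound -/

theorem mainTheorem4 (m n r : ℕ) (hr : 1 ≤ r) (hrm : r < m)
    (U : (Fin n → Bool) → Matrix.unitaryGroup (Qubits (m - 1)) ℂ) :
    distFromMixed (fun k => idTensor (lt_of_le_of_lt (Nat.zero_le r) hrm)
        (U k : Matrix (Qubits (m - 1)) (Qubits (m - 1)) ℂ)) (r - 1) ≤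
      5 * distFromMixed (fun k => (U k : Matrix (Qubits (m - 1)) (Qubits (m - 1)) ℂ)) (r - 1) +
        800 * (r : ℝ) * Real.sqrt (m : ℝ) / (2 : ℝ) ^ ((m : ℝ) / 2) := by
  have hm : 0 < m := lt_of_le_of_lt (Nat.zero_le r) hrm
  rw [distFromMixed_eq_traceNorm_defect, distFromMixed_eq_traceNorm_defect]
  set ε := traceNorm (defect (fun k => (U k : Matrix (Qubits (m - 1)) (Qubits (m - 1)) ℂ)) (r - 1))
  have hε : 0 ≤ ε := traceNorm_nonneg _
  have h1 := traceNorm_defect_le_six_mul (splitFirst hm)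
    (fun k => (U k : Matrix (Qubits (m - 1)) (Qubits (m - 1)) ℂ)) (r - 1)
  have h2 := traceNorm_qubitBlock_defect_le (splitFirst hm)
    (fun k => (U k : Matrix (Qubits (m - 1)) (Qubits (m - 1)) ℂ)) (r - 1)
  have hcard : (Fintype.card (Qubits m) : ℝ) = 2 ^ m := by simp
  rw [hcard] at h2
  -- The error obtained decays like `2 ^ (-m)`, so a crude comparison with the stated `2 ^ (-m/2)`
  -- suffices: the final step needs only `3 ≤ 5` and `6 ≤ 800`.
  have h3 : ((r - 1 : ℕ) : ℝ) / (2 * 2 ^ m) ≤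
      r * Real.sqrt m / (2 : ℝ) ^ ((m : ℝ) / 2) := by
    have hr' : ((r - 1 : ℕ) : ℝ) ≤ r := by exact_mod_cast Nat.sub_le r 1
    have hsm : 1 ≤ Real.sqrt m := Real.one_le_sqrt.mpr (by exact_mod_cast hm)
    have hpow : (2 : ℝ) ^ ((m : ℝ) / 2) ≤ 2 * 2 ^ m := by
      calc (2 : ℝ) ^ ((m : ℝ) / 2) ≤ (2 : ℝ) ^ (m : ℝ) :=
            Real.rpow_le_rpow_of_exponent_le one_le_two (half_le_self m.cast_nonneg)
        _ = 2 ^ m := Real.rpow_natCast 2 m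
        _ ≤ 2 * 2 ^ m := by linarith [pow_pos (zero_lt_two (α := ℝ)) m]
    have hr0 : (0 : ℝ) ≤ r := r.cast_nonneg
    refine div_le_div₀ (by positivity) ?_ (by positivity) hpow
    exact hr'.trans (le_mul_of_one_le_right hr0 hsm)
  have h4 : 800 * (r : ℝ) * Real.sqrt m / (2 : ℝ) ^ ((m : ℝ) / 2) =
      800 * (r * Real.sqrt m / (2 : ℝ) ^ ((m : ℝ) / 2)) := by ring
  have h5 : 0 ≤ r * Real.sqrt m / (2 : ℝ) ^ ((m : ℝ) / 2) := by positivity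
  rw [h4]
  refine h1.trans ?_
  linarith
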